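/- Let $N\ge 3$ be an integer, $\lambda\in\mathbb R$, $\beta\ge 0$, $q\ge 1$, and put $2^*=\frac{2N}{N-2}$, $u_+=\max\{u,0\}$. Let $B\subset\mathbb R^N$ be the open unit ball centered at the origin. Assume that at least one of the following holds: (i) $q\le\frac{2\beta+N+2}{N-2}$ and $\lambda\le 0$; (ii) $q\ge\frac{2\beta+N+2}{N-2}$ and $\lambda\ge 0$; (iii) $\beta=0$ and $q=\frac{N+2}{N-2}$ (with $\lambda\in\mathbb R$ arbitrary). Below, a solution in a bounded domain $\Omega\subset\mathbb R^N$ is a function $u\in C^1(\overline\Omega)$ that satisfies the equation weakly, that is, against all test functions in $C_c^\infty(\Omega)$, and vanishes on $\partial\Omega$. (a) The problem $$-\Delta u=u^{2^*-1}+\lambda|x|^\beta u_+^q,\quad u>0\ \text{ in }\Omega,\qquad u=0\ \text{ on }\partial\Omega$$ has no solution when $\Omega=B$, and more generally has no solution when $\Omega$ is any bounded domain with $C^\infty$ boundary that is star-shaped with respect to the origin. (b) If $\Omega$ is a bounded domain with $C^\infty$ boundary that is star-shaped with respect to the origin, then the problem $$-\Delta u=|u|^{2^*-2}u+\lambda|x|^\beta|u|^{q-1}u\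 \text{ in }\Omega,\qquad u=0\ \text{ on }\partial\Omega$$ has no solution $u\not\equiv 0$, whether or not $u$ changes sign. -/

import Mathlib

open scoped ContDiff

noncomputable section

/-- The critical Sobolev exponent `2^* = 2N/(N-2)`. -/
def sobolevExp (N : ℕ) : ℝ := 2 * (N : ℝ) / ((N : ℝ) - 2)

/-- A bounded smooth domain of `ℝ^N`: a bounded, open, connected, nonempty set whose boundary is
locally a regular level set of a `C^∞` function, with the domain lying on one side of it. -/
structure IsBoundedSmoothDomain {N : ℕ} (Ω : Set (EuclideanSpace ℝ (Fin N))) : Prop where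
  isOpen : IsOpen Ω
  isConnected : IsConnected Ω
  isBounded : Bornology.IsBounded Ω
  smooth_boundary : ∀ p ∈ frontier Ω,
    ∃ (U : Set (EuclideanSpace ℝ (Fin N))) (ρ : EuclideanSpace ℝ (Fin N) → ℝ),
      IsOpen U ∧ p ∈ U ∧ ContDiffOn ℝ ∞ ρ U ∧ gradient ρ p ≠ 0 ∧
        Ω ∩ U = {x | x ∈ U ∧ ρ x < 0}

/-- `u ∈ C^1(closure Ω)`: `u` is continuous on the closure, is `C^1` in `Ω`, and its gradient
extends continuously to the closure. -/
structure IsC1UpToBoundary {N : ℕ} (Ω : Set (EuclideanSpace ℝ (Fin N)))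
    (u : EuclideanSpace ℝ (Fin N) → ℝ) : Prop where
  continuousOn : ContinuousOn u (closure Ω)
  contDiffOn : ContDiffOn ℝ 1 u Ω
  gradient_extends : ∃ G : EuclideanSpace ℝ (Fin N) → EuclideanSpace ℝ (Fin N),
    ContinuousOn G (closure Ω) ∧ ∀ x ∈ Ω, G x = gradient u x

/-- `u ∈ C^1(closure Ω)` solves the Dirichlet problem `-Δ u = h(x, u)` in `Ω`, `u = 0` on `∂Ω`,
the equation being understood in the weak sense, against all test functions in `C_c^∞(Ω)`. -/
structure IsDirichletSolution {N : ℕ} (Ω : Set (EuclideanSpace ℝ (Fin N)))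
    (h : EuclideanSpace ℝ (Fin N) → ℝ → ℝ) (u : EuclideanSpace ℝ (Fin N) → ℝ) : Prop where
  isC1 : IsC1UpToBoundary Ω u
  boundary : ∀ x ∈ frontier Ω, u x = 0
  weak : ∀ φ : EuclideanSpace ℝ (Fin N) → ℝ, ContDiff ℝ ∞ φ → HasCompactSupport φ →
    tsupport φ ⊆ Ω →
      ∫ x in Ω, inner ℝ (gradient u x) (gradient φ x) = ∫ x in Ω, h x (u x) * φ x

/-- `u` solves `-Δ u = u^{(N+2)/(N-2)} + lam |x|^β u_+^q`, `u > 0` in `Ω`, `u = 0` on `∂Ω`. -/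
def IsPositiveSolution {N : ℕ} (Ω : Set (EuclideanSpace ℝ (Fin N))) (lam β q : ℝ)
    (u : EuclideanSpace ℝ (Fin N) → ℝ) : Prop :=
  IsDirichletSolution Ω
    (fun x t => t ^ (((N : ℝ) + 2) / ((N : ℝ) - 2)) + lam * (‖x‖ ^ β * (max t 0) ^ q)) u ∧
  ∀ x ∈ Ω, 0 < u x

/-- `u`, possibly changing sign, is a nontrivial solution of
`-Δ u = |u|^{2^*-2} u + lam |x|^β |u|^{q-1} u` in `Ω`, `u = 0` on `∂Ω`. -/
def IsNontrivialSolution {N : ℕ} (Ω : Set (EuclideanSpace ℝ (Fin N))) (lam β q : ℝ)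
    (u : EuclideanSpace ℝ (Fin N) → ℝ) : Prop :=
  IsDirichletSolution Ω
    (fun x t => |t| ^ (sobolevExp N - 2) * t + lam * ‖x‖ ^ β * (|t| ^ (q - 1) * t)) u ∧
  ∃ x ∈ Ω, u x ≠ 0

end

/-! For a solution of $-\Delta u=F$ vanishing on $\partial\Omega$, the formal Pohozaev identity
reads $\frac{2-d}{2}\int|\nabla u|^2-\int F\,x\cdot\nabla
u=\frac12\int_{\partial\Omega}|\partial_\nu u|^2\,x\cdot\nu$. The right side is nonnegative on a
star-shaped domain. For the present nonlinearity, scaling gives the left side the value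
$\lambda\left(\frac{d+\beta}{q+1}-\frac{d-2}{2}\right)\int|x|^\beta|u|^{q+1}$, because the critical
power cancels; each of the three cases makes this nonpositive (`coefficient_nonpos`,
`ExtendedSolution.pohozaev`). Equality may occur, so a contradiction needs unique continuation
rather than a strict sign.

Neither boundary integrals nor second derivatives appear. The solution is extended by zero, and
star-shapedness makes each dilate $u(tx)$ with $t\ge1$ vanish outside $\Omega$, so it serves as a
test function (`weak_dilation`). Letting $t\to1^+$, with Young's inequality for the cross term,
yields `variational_inequality`: a one-sided Pohozaev inequality with weight $R^{2m}-|x|^{2m}\ge0$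
on $\Omega$.

Combined with the sign of the Pohozaev functional, the $R^{2m}$ terms drop out and leave, with
$m=j+1$, $\tau=\frac d2+j$ and $W=x\cdot\nabla u+\tau u$, the estimate `carleman`:
$2m\int|x|^{2m-2}W^2\le\int|x|^{2m}FW$. Since $|F|\le M|u|$, the right side is absorbed through
`hardy` once $j$ is large, and $u=0$ follows (`eq_zero`). Positive solutions are a special case of
nontrivial ones. -/

namespace Pohozaev

open MeasureTheory Filter Topology Set Metric
open scoped ContDiff Convolution
set_option linter.unusedSectionVars false

/-! ### Bounded measurable functions vanishing outside the domain -/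

section

variable {E : Type*} [NormedAddCommGroup E] [InnerProductSpace ℝ E] [FiniteDimensional ℝ E]
  [MeasurableSpace E] [BorelSpace E]

/-- A bounded measurable function that vanishes outside `Ω`. -/
structure BddIn (Ω : Set E) (g : E → ℝ) : Prop where
  measurable : Measurable g
  eq_zero : ∀ x ∉ Ω, g x = 0
  bound : ∃ C, ∀ x, |g x| ≤ C

namespace BddIn

variable {Ω : Set E} {f g : E → ℝ}

theorem mul (hf : BddIn Ω f) (hg : BddIn Ω g) : BddIn Ω (fun x => f x * g x) := by
  obtain ⟨C, hC⟩ := hf.bound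
  obtain ⟨K, hK⟩ := hg.bound
  refine ⟨hf.measurable.mul hg.measurable, fun x hx => by simp [hf.eq_zero x hx],
    C * K, fun x => ?_⟩
  rw [abs_mul]
  exact mul_le_mul (hC x) (hK x) (abs_nonneg _) ((abs_nonneg _).trans (hC x))

theorem add (hf : BddIn Ω f) (hg : BddIn Ω g) : BddIn Ω (fun x => f x + g x) := by
  obtain ⟨C, hC⟩ := hf.bound
  obtain ⟨K, hK⟩ := hg.bound
  exact ⟨hf.measurable.add hg.measurable,
    fun x hx => by simp [hf.eq_zero x hx, hg.eq_zero x hx],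
    C + K, fun x => (abs_add_le _ _).trans (add_le_add (hC x) (hK x))⟩

theorem const_mul (c : ℝ) (hf : BddIn Ω f) : BddIn Ω (fun x => c * f x) := by
  obtain ⟨C, hC⟩ := hf.bound
  refine ⟨hf.measurable.const_mul c, fun x hx => by simp [hf.eq_zero x hx],
    |c| * C, fun x => ?_⟩
  rw [abs_mul]
  exact mul_le_mul_of_nonneg_left (hC x) (abs_nonneg _)

theorem abs (hf : BddIn Ω f) : BddIn Ω (fun x => |f x|) := by
  obtain ⟨C, hC⟩ := hf.bound
  exact ⟨hf.measurable.abs, fun x hx => by simp [hf.eq_zero x hx],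
    C, fun x => by simpa using hC x⟩

theorem continuous_mul (hΩ : Bornology.IsBounded Ω) (hf : Continuous f) (hg : BddIn Ω g) :
    BddIn Ω (fun x => f x * g x) := by
  obtain ⟨C, hC⟩ := hΩ.isCompact_closure.exists_bound_of_continuousOn hf.continuousOn
  obtain ⟨K, hK⟩ := hg.bound
  refine ⟨hf.measurable.mul hg.measurable, fun x hx => by simp [hg.eq_zero x hx],
    |C| * K, fun x => ?_⟩
  have hK0 : 0 ≤ K := (abs_nonneg _).trans (hK x)
  by_cases hx : x ∈ Ω
  · rw [abs_mul]
    exact mul_le_mul ((hC x (subset_closure hx)).trans (le_abs_self C)) (hK x)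
      (abs_nonneg _) (abs_nonneg _)
  · simp only [hg.eq_zero x hx, mul_zero, abs_zero]
    positivity

theorem integrable {μ : Measure E} [IsFiniteMeasureOnCompacts μ] (hΩ : Bornology.IsBounded Ω)
    (hg : BddIn Ω g) : Integrable g μ := by
  obtain ⟨C, hC⟩ := hg.bound
  have h1 : IntegrableOn g (closure Ω) μ :=
    Measure.integrableOn_of_bounded (M := C) hΩ.isCompact_closure.measure_lt_top.ne
      hg.measurable.aestronglyMeasurable (Eventually.of_forall hC)
  exact (integrableOn_iff_integrable_of_support_subset fun x hx => by
    by_contra h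
    exact hx (hg.eq_zero x fun h' => h (subset_closure h'))).1 h1

end BddIn

/-! ### Enlarging the class of test functions by mollification -/

theorem measurable_fderiv_apply {ψ : E → ℝ} (hψ : Continuous (fderiv ℝ ψ)) {D : E → E}
    (hD : Measurable D) : Measurable (fun x => fderiv ℝ ψ x (D x)) := by
  have h : Continuous (fun p : E × E => fderiv ℝ ψ p.1 p.2) :=
    (hψ.comp continuous_fst).clm_apply continuous_snd
  exact h.measurable.comp (measurable_id.prodMk hD)

/-- Test functions of class `C^1` are admissible in the weak equation. -/
theorem weak_of_contDiff_one {μ : Measure E} [μ.IsAddHaarMeasure] {Ω : Set E}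
    (hΩ : IsOpen Ω) (hΩb : Bornology.IsBounded Ω) {D : E → E} {F : E → ℝ}
    (hD : Measurable D) (hDb : ∃ K, ∀ x, ‖D x‖ ≤ K) (hD0 : ∀ x ∉ Ω, D x = 0)
    (hF : BddIn Ω F)
    (weak : ∀ φ : E → ℝ, ContDiff ℝ ∞ φ → HasCompactSupport φ → tsupport φ ⊆ Ω →
      ∫ x, fderiv ℝ φ x (D x) ∂μ = ∫ x, F x * φ x ∂μ)
    {ψ : E → ℝ} (hψ : ContDiff ℝ 1 ψ) (hψc : HasCompactSupport ψ) (hψΩ : tsupport ψ ⊆ Ω) :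
    ∫ x, fderiv ℝ ψ x (D x) ∂μ = ∫ x, F x * ψ x ∂μ := by
  -- Mollifying at radius at most δ keeps the support inside the closed δ-thickening of `tsupport
  -- ψ`, hence in Ω.
  obtain ⟨δ, hδ, hδΩ⟩ := hψc.isCompact.exists_cthickening_subset_open hΩ hψΩ
  obtain ⟨K, hK⟩ := hDb
  let φ : ℕ → ContDiffBump (0 : E) := fun n =>
    ⟨δ / (n + 2) / 2, δ / (n + 2), by positivity, by
      have : 0 < δ / (n + 2) := by positivity
      linarith⟩
  have hφr : Tendsto (fun n => (φ n).rOut) atTop (𝓝 0) := by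
    have : Tendsto (fun n : ℕ => δ / ((n : ℝ) + 2)) atTop (𝓝 0) :=
      Tendsto.div_atTop tendsto_const_nhds
        (tendsto_atTop_add_const_right _ _ tendsto_natCast_atTop_atTop)
    exact this
  have hφδ : ∀ n, (φ n).rOut ≤ δ := fun n => div_le_self hδ.le (by linarith [n.cast_nonneg (α := ℝ)])
  let g : ℕ → E → ℝ := fun n => (φ n).normed μ ⋆[ContinuousLinearMap.lsmul ℝ ℝ, μ] ψ
  have hli : ∀ n, LocallyIntegrable ((φ n).normed μ) μ := fun n =>
    (φ n).continuous_normed.locallyIntegrable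
  have hgs : ∀ n, ContDiff ℝ ∞ (g n) := fun n =>
    HasCompactSupport.contDiff_convolution_left _ (φ n).hasCompactSupport_normed
      (φ n).contDiff_normed hψ.continuous.locallyIntegrable
  have hgc : ∀ n, HasCompactSupport (g n) := fun n =>
    (φ n).hasCompactSupport_normed.convolution _ hψc
  have hgΩ : ∀ n, tsupport (g n) ⊆ Ω := by
    intro n
    refine (closure_minimal ?_ isClosed_cthickening).trans hδΩ
    refine (support_convolution_subset _).trans ?_
    rw [(φ n).support_normed_eq]
    rintro x ⟨a, ha, b, hb, rfl⟩
    refine mem_cthickening_of_dist_le _ b _ _ (subset_closure hb) ?_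
    simp only [mem_ball, dist_zero_right] at ha
    simpa using ha.le.trans (hφδ n)
  have hdψ : Continuous (fderiv ℝ ψ) := hψ.continuous_fderiv one_ne_zero
  have hdg : ∀ n x v, fderiv ℝ (g n) x v =
      ((φ n).normed μ ⋆[ContinuousLinearMap.lsmul ℝ ℝ, μ] (fun y => fderiv ℝ ψ y v)) x := by
    intro n x v
    rw [(hψc.hasFDerivAt_convolution_right _ (hli n) hψ x).fderiv,
      convolution_precompR_apply _ (hli n) (hψc.fderiv ℝ) hdψ]
  obtain ⟨A, hA⟩ := hψc.exists_bound_of_continuous hψ.continuous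
  obtain ⟨A', hA'⟩ := (hψc.fderiv ℝ).exists_bound_of_continuous hdψ
  -- Averaging moves ψ by at most its oscillation 2A, so the mollified functions are bounded by 3A
  -- uniformly in n; the same reasoning bounds their derivatives.
  have hgb : ∀ n x, ‖g n x‖ ≤ 3 * A := by
    intro n x
    have := ContDiffBump.dist_normed_convolution_le (φ := φ n) (μ := μ) (x₀ := x) (ε := 2 * A)
      hψ.continuous.aestronglyMeasurable (fun y _ => by
        rw [dist_eq_norm]
        exact (norm_sub_le _ _).trans (by linarith [hA x, hA y]))
    rw [dist_eq_norm] at this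
    have h2 := norm_sub_norm_le (g n x) (ψ x)
    have h3 := hA x
    change ‖g n x - ψ x‖ ≤ _ at this
    linarith
  have hdgb : ∀ n x v, ‖fderiv ℝ (g n) x v‖ ≤ 3 * (A' * ‖v‖) := by
    intro n x v
    have hb : ∀ y, ‖fderiv ℝ ψ y v‖ ≤ A' * ‖v‖ := fun y =>
      (ContinuousLinearMap.le_opNorm _ _).trans
        (mul_le_mul_of_nonneg_right (hA' y) (norm_nonneg _))
    have := ContDiffBump.dist_normed_convolution_le (φ := φ n) (μ := μ) (x₀ := x)
      (ε := 2 * (A' * ‖v‖)) (g := fun y => fderiv ℝ ψ y v)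
      (hdψ.clm_apply continuous_const).aestronglyMeasurable (fun y _ => by
        rw [dist_eq_norm]
        exact (norm_sub_le _ _).trans (by linarith [hb x, hb y]))
    rw [dist_eq_norm, ← hdg] at this
    have h2 := norm_sub_norm_le (fderiv ℝ (g n) x v) (fderiv ℝ ψ x v)
    have h3 := hb x
    linarith
  have hind : ∀ c : ℝ, Integrable (Ω.indicator fun _ : E => c) μ := fun c =>
    (integrable_indicator_iff hΩ.measurableSet).2
      (integrableOn_const hΩb.measure_lt_top.ne)
  have hA'0 : 0 ≤ A' := (norm_nonneg _).trans (hA' 0)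
  have hA0 : 0 ≤ A := (norm_nonneg _).trans (hA 0)
  have h1 : Tendsto (fun n => ∫ x, fderiv ℝ (g n) x (D x) ∂μ) atTop
      (𝓝 (∫ x, fderiv ℝ ψ x (D x) ∂μ)) := by
    refine tendsto_integral_of_dominated_convergence
      (Ω.indicator fun _ => 3 * (A' * K)) (fun n => ?_) (hind _) (fun n => ?_) ?_
    · exact (measurable_fderiv_apply ((hgs n).continuous_fderiv (by simp))
        hD).aestronglyMeasurable
    · refine Eventually.of_forall fun x => ?_
      by_cases hx : x ∈ Ω
      · rw [indicator_of_mem hx]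
        exact (hdgb n x _).trans (by gcongr; exact hK x)
      · simp [hD0 x hx, hx]
    · refine Eventually.of_forall fun x => ?_
      simp only [hdg]
      exact ContDiffBump.convolution_tendsto_right_of_continuous hφr
        (hdψ.clm_apply continuous_const) x
  obtain ⟨B, hB⟩ := hF.bound
  have hB0 : 0 ≤ B := (abs_nonneg _).trans (hB 0)
  have h2 : Tendsto (fun n => ∫ x, F x * g n x ∂μ) atTop (𝓝 (∫ x, F x * ψ x ∂μ)) := by
    refine tendsto_integral_of_dominated_convergence
      (Ω.indicator fun _ => B * (3 * A)) (fun n => ?_) (hind _) (fun n => ?_) ?_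
    · exact (hF.measurable.mul (hgs n).continuous.measurable).aestronglyMeasurable
    · refine Eventually.of_forall fun x => ?_
      by_cases hx : x ∈ Ω
      · rw [indicator_of_mem hx, norm_mul]
        exact mul_le_mul (hB x) (hgb n x) (norm_nonneg _) hB0
      · simp [hF.eq_zero x hx, hx]
    · refine Eventually.of_forall fun x => Tendsto.const_mul _ ?_
      exact ContDiffBump.convolution_tendsto_right_of_continuous hφr hψ.continuous x
  refine tendsto_nhds_unique h1 (h2.congr fun n => ?_)
  exact (weak _ (hgs n) (hgc n) (hgΩ n)).symm

/-! ### Smooth truncations near zero -/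

/-- A smooth function that vanishes near `0` and is the identity away from `0`. -/
noncomputable def trunc (s : ℝ) : ℝ := s * Real.smoothTransition (s ^ 2 - 1)

theorem contDiff_trunc : ContDiff ℝ ∞ trunc :=
  contDiff_id.mul (Real.smoothTransition.contDiff.comp ((contDiff_id.pow 2).sub contDiff_const))

theorem trunc_of_abs_le {s : ℝ} (hs : |s| ≤ 1) : trunc s = 0 := by
  have : s ^ 2 ≤ 1 := (sq_le_one_iff_abs_le_one s).2 hs
  rw [trunc, Real.smoothTransition.zero_of_nonpos (by linarith), mul_zero]

theorem trunc_of_le_abs {s : ℝ} (hs : 2 ≤ |s|) : trunc s = s := by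
  have : 4 ≤ s ^ 2 := by rw [← sq_abs]; nlinarith
  rw [trunc, Real.smoothTransition.one_of_one_le (by linarith), mul_one]

theorem abs_trunc_le (s : ℝ) : |trunc s| ≤ |s| := by
  rw [trunc, abs_mul, abs_of_nonneg (Real.smoothTransition.nonneg _)]
  exact mul_le_of_le_one_right (abs_nonneg _) (Real.smoothTransition.le_one _)

theorem deriv_trunc_of_lt_abs {s : ℝ} (hs : 2 < |s|) : deriv trunc s = 1 := by
  have : trunc =ᶠ[𝓝 s] id := by
    filter_upwards [continuous_abs.continuousAt.eventually (lt_mem_nhds hs)] with y hy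
    exact trunc_of_le_abs hy.le
  rw [this.deriv_eq, deriv_id]

theorem exists_deriv_trunc_bound : ∃ C, ∀ s, |deriv trunc s| ≤ C := by
  obtain ⟨C, hC⟩ := (isCompact_Icc (a := (-2 : ℝ)) (b := 2)).exists_bound_of_continuousOn
    (contDiff_trunc.continuous_deriv (by simp)).continuousOn
  refine ⟨max C 1, fun s => ?_⟩
  rcases le_or_gt |s| 2 with h | h
  · exact (hC s (abs_le.1 h)).trans (le_max_left _ _)
  · rw [deriv_trunc_of_lt_abs h]
    simp

/-- The rescaled truncations. -/
noncomputable def truncAt (k s : ℝ) : ℝ := k⁻¹ * trunc (k * s)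

theorem contDiff_truncAt (k : ℝ) : ContDiff ℝ ∞ (truncAt k) :=
  contDiff_const.mul (contDiff_trunc.comp (contDiff_const.mul contDiff_id))

theorem deriv_truncAt {k : ℝ} (hk : 0 < k) (s : ℝ) :
    deriv (truncAt k) s = deriv trunc (k * s) := by
  have h1 : HasDerivAt trunc (deriv trunc (k * s)) (k * s) :=
    (contDiff_trunc.differentiable (by simp) _).hasDerivAt
  have h2 : HasDerivAt (fun s => k * s) k s := by simpa using (hasDerivAt_id s).const_mul k
  have h3 := (h1.comp s h2).const_mul k⁻¹
  rw [show truncAt k = fun y => k⁻¹ * (trunc ∘ fun s => k * s) y from rfl, h3.deriv]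
  field_simp

theorem truncAt_of_abs_le {k s : ℝ} (hk : 0 < k) (hs : |s| ≤ k⁻¹) : truncAt k s = 0 := by
  rw [truncAt, trunc_of_abs_le, mul_zero]
  rw [abs_mul, abs_of_pos hk]
  calc k * |s| ≤ k * k⁻¹ := by gcongr
    _ = 1 := mul_inv_cancel₀ hk.ne'

theorem abs_truncAt_le {k : ℝ} (hk : 0 < k) (s : ℝ) : |truncAt k s| ≤ |s| := by
  rw [truncAt, abs_mul, abs_of_pos (inv_pos.2 hk)]
  calc k⁻¹ * |trunc (k * s)| ≤ k⁻¹ * |k * s| :=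
        mul_le_mul_of_nonneg_left (abs_trunc_le _) (inv_pos.2 hk).le
    _ = |s| := by rw [abs_mul, abs_of_pos hk, inv_mul_cancel_left₀ hk.ne']

theorem eventually_two_lt {s : ℝ} (hs : s ≠ 0) : ∀ᶠ k : ℕ in atTop, 2 < |((k : ℝ) + 1) * s| := by
  have : Tendsto (fun k : ℕ => ((k : ℝ) + 1) * |s|) atTop atTop :=
    (tendsto_atTop_add_const_right _ _ tendsto_natCast_atTop_atTop).atTop_mul_const
      (abs_pos.2 hs)
  filter_upwards [this.eventually_gt_atTop 2] with k hk
  rwa [abs_mul, abs_of_pos (by positivity : (0 : ℝ) < k + 1)]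

theorem tendsto_truncAt (s : ℝ) :
    Tendsto (fun k : ℕ => truncAt ((k : ℝ) + 1) s) atTop (𝓝 s) := by
  rcases eq_or_ne s 0 with rfl | hs
  · have : ∀ k : ℕ, truncAt ((k : ℝ) + 1) 0 = 0 := fun k => by simp [truncAt, trunc]
    simp [this]
  · refine tendsto_const_nhds.congr' ?_
    filter_upwards [eventually_two_lt hs] with k hk
    rw [truncAt, trunc_of_le_abs hk.le, inv_mul_cancel_left₀ (by positivity)]

theorem tendsto_deriv_truncAt {s : ℝ} (hs : s ≠ 0) :
    Tendsto (fun k : ℕ => deriv (truncAt ((k : ℝ) + 1)) s) atTop (𝓝 1) := by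
  refine tendsto_const_nhds.congr' ?_
  filter_upwards [eventually_two_lt hs] with k hk
  rw [deriv_truncAt (by positivity), deriv_trunc_of_lt_abs hk]

/-! ### Solutions extended by zero, and their dilates as test functions -/

/-- A `C^1` weak solution of `-Δ u = F` in a bounded star-shaped open set `Ω` with zero boundary
values, extended by zero; `D` is its gradient in `Ω`, extended by zero. -/
structure ExtendedSolution (μ : Measure E) (Ω : Set E) (u : E → ℝ) (D : E → E) (F : E → ℝ) :
    Prop where
  isOpen : IsOpen Ω
  isBounded : Bornology.IsBounded Ω
  star : StarConvex ℝ 0 Ω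
  continuous : Continuous u
  u_eq_zero : ∀ x ∉ Ω, u x = 0
  D_eq_zero : ∀ x ∉ Ω, D x = 0
  hasFDerivAt : ∀ x ∈ Ω, HasFDerivAt u (innerSL ℝ (D x)) x
  continuousOn_D : ContinuousOn D Ω
  D_bound : ∃ K, ∀ x, ‖D x‖ ≤ K
  F_bddIn : BddIn Ω F
  weak : ∀ φ : E → ℝ, ContDiff ℝ ∞ φ → HasCompactSupport φ → tsupport φ ⊆ Ω →
    ∫ x, fderiv ℝ φ x (D x) ∂μ = ∫ x, F x * φ x ∂μ

open Classical in
theorem measurable_of_continuousOn_of_eq_zero {Y : Type*} [TopologicalSpace Y] [MeasurableSpace Y]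
    [BorelSpace Y] [Zero Y] {Ω : Set E} (hΩ : IsOpen Ω) {D : E → Y} (hD : ContinuousOn D Ω)
    (h0 : ∀ x ∉ Ω, D x = 0) : Measurable D := by
  have : D = Ω.piecewise D (fun _ => 0) := by
    ext x
    by_cases hx : x ∈ Ω
    · simp [hx]
    · simp [hx, h0 x hx]
  rw [this]
  exact hD.measurable_piecewise continuousOn_const hΩ.measurableSet

/-- This is how star-shapedness enters: a function supported in Ω, dilated by t ≥ 1, is still
supported in Ω. -/
theorem StarConvex.mem_of_smul_mem {Ω : Set E} (h : StarConvex ℝ 0 Ω) {t : ℝ} (ht : 1 ≤ t) {x : E}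
    (hx : t • x ∈ Ω) : x ∈ Ω := by
  have ht0 : 0 < t := by linarith
  have := h.smul_mem hx (inv_nonneg.2 ht0.le) (inv_le_one_of_one_le₀ ht)
  rwa [inv_smul_smul₀ ht0.ne'] at this

namespace ExtendedSolution

variable {μ : Measure E} [μ.IsAddHaarMeasure] {Ω : Set E} {u : E → ℝ} {D : E → E} {F : E → ℝ}

theorem measurable_D (h : ExtendedSolution μ Ω u D F) : Measurable D :=
  measurable_of_continuousOn_of_eq_zero h.isOpen h.continuousOn_D h.D_eq_zero

theorem exists_bound (h : ExtendedSolution μ Ω u D F) : ∃ R, 0 < R ∧ ∀ x ∈ Ω, ‖x‖ ≤ R :=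
  h.isBounded.exists_pos_norm_le

theorem bddIn_u (h : ExtendedSolution μ Ω u D F) : BddIn Ω u := by
  obtain ⟨C, hC⟩ := h.isBounded.isCompact_closure.exists_bound_of_continuousOn
    h.continuous.continuousOn
  refine ⟨h.continuous.measurable, h.u_eq_zero, |C|, fun x => ?_⟩
  by_cases hx : x ∈ Ω
  · exact (hC x (subset_closure hx)).trans (le_abs_self C)
  · simp [h.u_eq_zero x hx]

theorem bddIn_norm_sq (h : ExtendedSolution μ Ω u D F) : BddIn Ω (fun x => ‖D x‖ ^ 2) := by
  obtain ⟨K, hK⟩ := h.D_bound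
  refine ⟨h.measurable_D.norm.pow_const 2, fun x hx => by simp [h.D_eq_zero x hx], K ^ 2,
    fun x => ?_⟩
  rw [abs_of_nonneg (by positivity)]
  exact pow_le_pow_left₀ (norm_nonneg _) (hK x) 2

/-- The radial component `⟪∇u, x⟫` of the gradient. -/
theorem bddIn_inner (h : ExtendedSolution μ Ω u D F) : BddIn Ω (fun x => inner ℝ (D x) x) := by
  obtain ⟨K, hK⟩ := h.D_bound
  obtain ⟨R, hR, hΩ⟩ := h.exists_bound
  have hK0 : 0 ≤ K := (norm_nonneg _).trans (hK 0)
  refine ⟨h.measurable_D.inner measurable_id, fun x hx => by simp [h.D_eq_zero x hx], K * R,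
    fun x => ?_⟩
  by_cases hx : x ∈ Ω
  · exact (abs_real_inner_le_norm _ _).trans
      (mul_le_mul (hK x) (hΩ x hx) (norm_nonneg _) hK0)
  · simp only [h.D_eq_zero x hx, inner_zero_left, abs_zero]
    positivity

/-- The extension of u by zero may have a gradient jump across the boundary. Near any point outside
Ω continuity makes |u| < 1/k, where the truncation vanishes identically, so the jump is removed. -/
theorem contDiff_truncAt_comp (h : ExtendedSolution μ Ω u D F) {k : ℝ} (hk : 0 < k) :
    ContDiff ℝ 1 (fun x => truncAt k (u x)) ∧
      ∀ x, HasFDerivAt (fun x => truncAt k (u x))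
        (innerSL ℝ (deriv (truncAt k) (u x) • D x)) x := by
  have hd : ∀ x, HasFDerivAt (fun x => truncAt k (u x))
        (innerSL ℝ (deriv (truncAt k) (u x) • D x)) x := by
    intro x
    by_cases hx : x ∈ Ω
    · have h1 : HasDerivAt (truncAt k) (deriv (truncAt k) (u x)) (u x) :=
        ((contDiff_truncAt k).differentiable (by simp) _).hasDerivAt
      have := h1.comp_hasFDerivAt x (h.hasFDerivAt x hx)
      rwa [← map_smul] at this
    · rw [h.D_eq_zero x hx, smul_zero, map_zero]
      refine (hasFDerivAt_const (0 : ℝ) x).congr_of_eventuallyEq ?_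
      have : ∀ᶠ y in 𝓝 x, |u y| < k⁻¹ := by
        refine (h.continuous.abs.continuousAt (x := x)).eventually (gt_mem_nhds ?_)
        simpa [h.u_eq_zero x hx] using hk
      filter_upwards [this] with y hy
      exact truncAt_of_abs_le hk hy.le
  refine ⟨contDiff_one_iff_fderiv.2 ⟨fun x => (hd x).differentiableAt, ?_⟩, hd⟩
  have hfd : fderiv ℝ (fun x => truncAt k (u x)) =
      fun x => innerSL ℝ (deriv (truncAt k) (u x) • D x) := funext fun x => (hd x).fderiv
  rw [hfd, continuous_iff_continuousAt]
  intro x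
  have hT : Continuous (fun x => deriv (truncAt k) (u x)) :=
    ((contDiff_truncAt k).continuous_deriv (by simp)).comp h.continuous
  refine (innerSL ℝ).continuous.continuousAt.comp ?_
  by_cases hx : x ∈ Ω
  · exact hT.continuousAt.smul (h.continuousOn_D.continuousAt (h.isOpen.mem_nhds hx))
  · have : ∀ᶠ y in 𝓝 x, |u y| < k⁻¹ := by
      refine (h.continuous.abs.continuousAt (x := x)).eventually (gt_mem_nhds ?_)
      simpa [h.u_eq_zero x hx] using hk
    refine (continuousAt_const (y := (0 : E))).congr ?_
    filter_upwards [this.eventually_nhds] with y hy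
    have h0 : truncAt k =ᶠ[𝓝 (u y)] fun _ => 0 := by
      have : ∀ᶠ s in 𝓝 (u y), |s| < k⁻¹ :=
        continuous_abs.continuousAt.eventually (gt_mem_nhds hy.self_of_nhds)
      filter_upwards [this] with s hs
      exact truncAt_of_abs_le hk hs.le
    rw [h0.deriv_eq, deriv_const, zero_smul]

/-- The truncations of u are differentiable on the whole space, which is convex although Ω need not
be, with gradients bounded uniformly in k. The mean value inequality therefore passes to the limit.
-/
theorem exists_lipschitz (h : ExtendedSolution μ Ω u D F) :
    ∃ L, 0 ≤ L ∧ ∀ x y, |u x - u y| ≤ L * ‖x - y‖ := by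
  obtain ⟨K, hK⟩ := h.D_bound
  obtain ⟨C, hC⟩ := exists_deriv_trunc_bound
  have hK0 : 0 ≤ K := (norm_nonneg _).trans (hK 0)
  have hC0 : 0 ≤ C := (abs_nonneg _).trans (hC 0)
  refine ⟨C * K, by positivity, fun x y => ?_⟩
  have hlim : Tendsto (fun k : ℕ => |truncAt ((k : ℝ) + 1) (u x) - truncAt ((k : ℝ) + 1) (u y)|)
      atTop (𝓝 |u x - u y|) := ((tendsto_truncAt _).sub (tendsto_truncAt _)).abs
  refine le_of_tendsto' hlim fun k => ?_
  have hk : (0 : ℝ) < k + 1 := by positivity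
  obtain ⟨-, hd⟩ := h.contDiff_truncAt_comp hk
  refine convex_univ.norm_image_sub_le_of_norm_fderiv_le (𝕜 := ℝ)
    (f := fun x => truncAt ((k : ℝ) + 1) (u x))
    (fun z _ => (hd z).differentiableAt) (fun z _ => ?_) (mem_univ y) (mem_univ x)
  rw [(hd z).fderiv, innerSL_apply_norm, norm_smul, deriv_truncAt hk]
  exact mul_le_mul (hC _) (hK z) (norm_nonneg _) hC0

/-- The gradient vanishes almost everywhere on the zero set. -/
theorem ae_D_eq_zero (h : ExtendedSolution μ Ω u D F) : ∀ᵐ x ∂μ, u x = 0 → D x = 0 := by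
  rcases subsingleton_or_nontrivial E with hE | hE
  · exact Eventually.of_forall fun x _ => Subsingleton.elim _ _
  obtain ⟨e, he⟩ := exists_ne (0 : E)
  let s : Set E := Ω ∩ u ⁻¹' {0}
  have hs : MeasurableSet s :=
    h.isOpen.measurableSet.inter (h.continuous.measurable (measurableSet_singleton 0))
  -- The available a.e. comparison concerns maps from E to E, hence the multiplication by a fixed
  -- vector e. On the zero set the map is constant, so it is approximated by 0 with error constant
  -- 0, which forces its derivative to vanish at almost every point of that set.
  have h1 : ApproximatesLinearOn (fun x => u x • e) (0 : E →L[ℝ] E) s 0 := by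
    intro x hx y hy
    have hx0 : u x = 0 := hx.2
    have hy0 : u y = 0 := hy.2
    simp [hx0, hy0]
  have h2 := h1.norm_fderiv_sub_le μ hs (fun x => (innerSL ℝ (D x)).smulRight e)
    (fun x hx => ((h.hasFDerivAt x hx.1).smul_const e).hasFDerivWithinAt)
  rw [ae_restrict_iff' hs] at h2
  filter_upwards [h2] with x hx hu
  by_cases hxΩ : x ∈ Ω
  · have h3 := hx ⟨hxΩ, hu⟩
    rw [sub_zero, nonpos_iff_eq_zero, nnnorm_eq_zero] at h3
    have h4 := congrArg (fun T : E →L[ℝ] E => T (D x)) h3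
    simpa [he] using h4
  · exact h.D_eq_zero x hxΩ

theorem ae_smul (h : ExtendedSolution μ Ω u D F) {t : ℝ} (ht : t ≠ 0) :
    ∀ᵐ x ∂μ, u (t • x) = 0 → D (t • x) = 0 := by
  have h1 := h.ae_D_eq_zero
  rw [ae_iff] at h1 ⊢
  have h2 := Measure.addHaar_preimage_smul μ ht {x | ¬(u x = 0 → D x = 0)}
  rw [h1, mul_zero] at h2
  exact h2

theorem bddIn_of_smul (h : ExtendedSolution μ Ω u D F) {t : ℝ} (ht : 1 ≤ t) {g : E → ℝ}
    (hg : BddIn Ω g) : BddIn Ω (fun x => g (t • x)) := by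
  obtain ⟨C, hC⟩ := hg.bound
  exact ⟨hg.measurable.comp (measurable_const_smul t),
    fun x hx => hg.eq_zero _ fun h' => hx (StarConvex.mem_of_smul_mem h.star ht h'),
    C, fun x => hC _⟩

theorem bddIn_inner_smul (h : ExtendedSolution μ Ω u D F) (t : ℝ) :
    BddIn Ω (fun x => inner ℝ (D (t • x)) (D x)) := by
  obtain ⟨K, hK⟩ := h.D_bound
  have hK0 : 0 ≤ K := (norm_nonneg _).trans (hK 0)
  refine ⟨(h.measurable_D.comp (measurable_const_smul t)).inner h.measurable_D,
    fun x hx => by simp [h.D_eq_zero x hx], K * K, fun x => ?_⟩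
  exact (abs_real_inner_le_norm _ _).trans (mul_le_mul (hK _) (hK _) (norm_nonneg _) hK0)

theorem bddIn_fderiv_apply (h : ExtendedSolution μ Ω u D F) {ζ : E → ℝ} (hζ : ContDiff ℝ 1 ζ) :
    BddIn Ω (fun x => fderiv ℝ ζ x (D x)) := by
  obtain ⟨K, hK⟩ := h.D_bound
  have hdζ := hζ.continuous_fderiv one_ne_zero
  have hK0 : 0 ≤ K := (norm_nonneg _).trans (hK 0)
  obtain ⟨C, hC⟩ := h.isBounded.isCompact_closure.exists_bound_of_continuousOn hdζ.continuousOn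
  refine ⟨?_, fun x hx => by simp [h.D_eq_zero x hx], |C| * K, fun x => ?_⟩
  · exact measurable_fderiv_apply hdζ h.measurable_D
  · by_cases hx : x ∈ Ω
    · exact (ContinuousLinearMap.le_opNorm _ _).trans
        (mul_le_mul ((hC x (subset_closure hx)).trans (le_abs_self C)) (hK x) (norm_nonneg _)
          (abs_nonneg _))
    · simp only [h.D_eq_zero x hx, map_zero, abs_zero]
      positivity

/-- The weak equation tested with `ζ` times a dilate of `u`. -/
theorem weak_dilation (h : ExtendedSolution μ Ω u D F) {ζ : E → ℝ} (hζ : ContDiff ℝ 1 ζ) {t : ℝ}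
    (ht : 1 ≤ t) :
    ∫ x, (t * (ζ x * inner ℝ (D (t • x)) (D x)) + u (t • x) * fderiv ℝ ζ x (D x)) ∂μ =
      ∫ x, F x * (ζ x * u (t • x)) ∂μ := by
  have ht0 : 0 < t := by linarith
  obtain ⟨C, hC⟩ := exists_deriv_trunc_bound
  have hutr := h.bddIn_of_smul ht h.bddIn_u
  have hG1 := BddIn.continuous_mul h.isBounded hζ.continuous (h.bddIn_inner_smul t)
  have hG2 := hutr.mul (h.bddIn_fderiv_apply hζ)
  have hG3 := h.F_bddIn.mul (BddIn.continuous_mul h.isBounded hζ.continuous hutr)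
  let v : ℕ → E → ℝ := fun k x => truncAt ((k : ℝ) + 1) (u (t • x))
  have hk0 : ∀ k : ℕ, (0 : ℝ) < k + 1 := fun k => by positivity
  have hvc : ∀ k, ContDiff ℝ 1 (v k) := fun k =>
    (h.contDiff_truncAt_comp (hk0 k)).1.comp (contDiff_const_smul t)
  have hvd : ∀ k x, HasFDerivAt (v k)
      (t • innerSL ℝ (deriv (truncAt ((k : ℝ) + 1)) (u (t • x)) • D (t • x))) x := by
    intro k x
    have h1 := (h.contDiff_truncAt_comp (hk0 k)).2 (t • x)
    have h2 : HasFDerivAt (fun x : E => t • x) (t • ContinuousLinearMap.id ℝ E) x :=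
      (hasFDerivAt_id x).const_smul t
    have h3 := h1.comp x h2
    have h4 : (innerSL ℝ (deriv (truncAt ((k : ℝ) + 1)) (u (t • x)) • D (t • x))).comp
        (t • ContinuousLinearMap.id ℝ E) =
        t • innerSL ℝ (deriv (truncAt ((k : ℝ) + 1)) (u (t • x)) • D (t • x)) := by
      ext y
      simp
    rwa [h4] at h3
  have hvb : ∀ k x, |v k x| ≤ |u (t • x)| := fun k x => abs_truncAt_le (hk0 k) _
  -- The support lies in the closed set where |u(tx)| ≥ 1/(k+1), and this set is contained in Ω.
  -- This holds even for t = 1.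
  have hsub : ∀ k, tsupport (fun x => ζ x * v k x) ⊆ Ω := by
    intro k
    have hcl : IsClosed {x | ((k : ℝ) + 1)⁻¹ ≤ |u (t • x)|} :=
      isClosed_le continuous_const (h.continuous.comp (continuous_const_smul t)).abs
    refine (closure_minimal (fun x hx => ?_) hcl).trans fun x hx => ?_
    · by_contra hlt
      simp only [mem_ofPred_eq, not_le] at hlt
      exact hx (by simp [v, truncAt_of_abs_le (hk0 k) hlt.le])
    · by_contra hxΩ
      simp only [mem_ofPred_eq, hutr.eq_zero x hxΩ, abs_zero] at hx
      exact absurd hx (not_le.2 (inv_pos.2 (hk0 k)))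
  have hcs : ∀ k, HasCompactSupport (fun x => ζ x * v k x) := fun k =>
    h.isBounded.isCompact_closure.of_isClosed_subset (isClosed_tsupport _)
      ((hsub k).trans subset_closure)
  have hw : ∀ k : ℕ, ∫ x, (t * (deriv (truncAt ((k : ℝ) + 1)) (u (t • x)) *
        (ζ x * inner ℝ (D (t • x)) (D x))) + v k x * fderiv ℝ ζ x (D x)) ∂μ =
      ∫ x, F x * (ζ x * v k x) ∂μ := by
    intro k
    rw [← weak_of_contDiff_one h.isOpen h.isBounded h.measurable_D h.D_bound h.D_eq_zero
      h.F_bddIn h.weak (hζ.mul (hvc k)) (hcs k) (hsub k)]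
    refine integral_congr_ae (Eventually.of_forall fun x => ?_)
    have h1 := ((hζ.differentiable one_ne_zero x).hasFDerivAt.mul (hvd k x)).fderiv
    have h2 : fderiv ℝ (fun x => ζ x * v k x) x (D x) = _ := congrArg (fun T => T (D x)) h1
    simp only [h2]
    simp
    ring
  have hmeas : ∀ k : ℕ, Measurable (v k) := fun k => (hvc k).continuous.measurable
  have hdm : ∀ k : ℕ, Measurable (fun x => deriv (truncAt ((k : ℝ) + 1)) (u (t • x))) := fun k =>
    (((contDiff_truncAt _).continuous_deriv (by simp)).comp
      (h.continuous.comp (continuous_const_smul t))).measurable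
  have hl1 : Tendsto (fun k : ℕ => ∫ x, (t * (deriv (truncAt ((k : ℝ) + 1)) (u (t • x)) *
        (ζ x * inner ℝ (D (t • x)) (D x))) + v k x * fderiv ℝ ζ x (D x)) ∂μ) atTop
      (𝓝 (∫ x, (t * (ζ x * inner ℝ (D (t • x)) (D x)) + u (t • x) * fderiv ℝ ζ x (D x)) ∂μ)) := by
    refine tendsto_integral_of_dominated_convergence
      (fun x => t * (C * |ζ x * inner ℝ (D (t • x)) (D x)|) + |u (t • x) * fderiv ℝ ζ x (D x)|)
      (fun k => ?_) ?_ (fun k => ?_) ?_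
    · exact ((((hdm k).mul hG1.measurable).const_mul t).add
        ((hmeas k).mul (h.bddIn_fderiv_apply hζ).measurable)).aestronglyMeasurable
    · exact (((hG1.abs.const_mul C).const_mul t).add hG2.abs).integrable h.isBounded
    · refine Eventually.of_forall fun x => (abs_add_le _ _).trans (add_le_add ?_ ?_)
      · rw [abs_mul, abs_of_pos ht0, abs_mul]
        refine mul_le_mul_of_nonneg_left (mul_le_mul_of_nonneg_right ?_ (abs_nonneg _)) ht0.le
        rw [deriv_truncAt (hk0 k)]
        exact hC _
      · rw [abs_mul, abs_mul]
        exact mul_le_mul_of_nonneg_right (hvb k x) (abs_nonneg _)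
    -- The derivative of the truncation tends to 1 only where u(tx) ≠ 0; elsewhere the gradient
    -- factor is zero almost everywhere.
    · filter_upwards [h.ae_smul ht0.ne'] with x hx
      refine Tendsto.add (Tendsto.const_mul _ ?_) ((tendsto_truncAt _).mul_const _)
      by_cases hu : u (t • x) = 0
      · simp [hx hu]
      · simpa using (tendsto_deriv_truncAt hu).mul_const (ζ x * inner ℝ (D (t • x)) (D x))
  have hl2 : Tendsto (fun k : ℕ => ∫ x, F x * (ζ x * v k x) ∂μ) atTop
      (𝓝 (∫ x, F x * (ζ x * u (t • x)) ∂μ)) := by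
    refine tendsto_integral_of_dominated_convergence
      (fun x => |F x * (ζ x * u (t • x))|) (fun k => ?_) (hG3.abs.integrable h.isBounded)
      (fun k => ?_) ?_
    · exact (h.F_bddIn.measurable.mul
        (hζ.continuous.measurable.mul (hmeas k))).aestronglyMeasurable
    · refine Eventually.of_forall fun x => ?_
      rw [Real.norm_eq_abs, abs_mul, abs_mul, abs_mul, abs_mul]
      exact mul_le_mul_of_nonneg_left (mul_le_mul_of_nonneg_left (hvb k x) (abs_nonneg _))
        (abs_nonneg _)
    · exact Eventually.of_forall fun x =>
        Tendsto.const_mul _ (Tendsto.const_mul _ (tendsto_truncAt _))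
  exact tendsto_nhds_unique hl1 (hl2.congr fun k => (hw k).symm)

end ExtendedSolution

/-! ### Differentiation with respect to dilations -/

namespace ExtendedSolution

variable {μ : Measure E} [μ.IsAddHaarMeasure] {Ω : Set E} {u : E → ℝ} {D : E → E} {F : E → ℝ}

/-- Differentiation of `∫ a g(u(t x))` with respect to the dilation parameter, at `t = 1⁺`. -/
theorem tendsto_integral_dilation (h : ExtendedSolution μ Ω u D F) {a : E → ℝ}
    (ha : IntegrableOn a Ω μ) (ham : Measurable a) {g : ℝ → ℝ} (hg : ContDiff ℝ 1 g) :
    Tendsto (fun t : ℝ => ∫ x, a x * ((g (u (t • x)) - g (u x)) / (t - 1)) ∂μ) (𝓝[>] 1)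
      (𝓝 (∫ x, a x * (deriv g (u x) * inner ℝ (D x) x) ∂μ)) := by
  obtain ⟨U, hU⟩ := h.bddIn_u.bound
  obtain ⟨R, hR, hΩR⟩ := h.exists_bound
  obtain ⟨L, hL0, hL⟩ := h.exists_lipschitz
  obtain ⟨C, hC⟩ := (isCompact_Icc (a := -U) (b := U)).exists_bound_of_continuousOn
    (hg.continuous_deriv_one).continuousOn
  have hmem : ∀ x, u x ∈ Icc (-U) U := fun x => abs_le.1 (hU x)
  have hC0 : 0 ≤ C := (norm_nonneg _).trans (hC _ (hmem 0))
  -- g is Lipschitz on the range of u, and u is Lipschitz; this supplies the domination of the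
  -- difference quotients.
  have hgL : ∀ x y, |g (u x) - g (u y)| ≤ C * (L * ‖x - y‖) := by
    intro x y
    have := (convex_Icc (-U) U).norm_image_sub_le_of_norm_deriv_le (f := g) (C := C)
      (fun s _ => hg.differentiable one_ne_zero s) (fun s hs => hC s hs) (hmem y) (hmem x)
    exact this.trans (mul_le_mul_of_nonneg_left (hL x y) hC0)
  have hgm : Measurable g := hg.continuous.measurable
  refine tendsto_integral_filter_of_dominated_convergence
    (Ω.indicator fun x => |a x| * (C * (L * R))) ?_ ?_ ?_ ?_
  · refine Eventually.of_forall fun t => ?_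
    exact (ham.mul (((hgm.comp (h.continuous.measurable.comp (measurable_const_smul t))).sub
      (hgm.comp h.continuous.measurable)).div_const _)).aestronglyMeasurable
  · filter_upwards [self_mem_nhdsWithin] with t ht
    have ht1 : (0 : ℝ) < t - 1 := sub_pos.2 ht
    refine Eventually.of_forall fun x => ?_
    by_cases hx : x ∈ Ω
    · rw [indicator_of_mem hx, Real.norm_eq_abs, abs_mul]
      refine mul_le_mul_of_nonneg_left ?_ (abs_nonneg _)
      rw [abs_div, abs_of_pos ht1, div_le_iff₀ ht1]
      refine (hgL _ _).trans ?_
      rw [show t • x - x = (t - 1) • x by rw [sub_smul, one_smul], norm_smul, Real.norm_eq_abs,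
        abs_of_pos ht1]
      calc C * (L * ((t - 1) * ‖x‖)) ≤ C * (L * ((t - 1) * R)) := by
            gcongr
            exact hΩR x hx
        _ = _ := by ring
    · have htx : t • x ∉ Ω := fun h' => hx (StarConvex.mem_of_smul_mem h.star ht.le h')
      simp [hx, h.u_eq_zero x hx, h.u_eq_zero _ htx]
  · exact (integrable_indicator_iff h.isOpen.measurableSet).2 (ha.abs.mul_const _)
  · refine Eventually.of_forall fun x => ?_
    refine Tendsto.const_mul _ ?_
    by_cases hx : x ∈ Ω
    · have h1 : HasDerivAt (fun t : ℝ => t • x) x 1 := by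
        simpa using (hasDerivAt_id (1 : ℝ)).smul_const x
      have h2 : HasFDerivAt u (innerSL ℝ (D x)) ((1 : ℝ) • x) := by
        rw [one_smul]
        exact h.hasFDerivAt x hx
      have h3 : HasDerivAt g (deriv g (u x)) (u ((1 : ℝ) • x)) := by
        rw [one_smul]
        exact (hg.differentiable one_ne_zero _).hasDerivAt
      have h4 := (h3.comp (1 : ℝ) (h2.comp_hasDerivAt (1 : ℝ) h1)).tendsto_slope
      refine (h4.mono_left (nhdsWithin_mono _ fun t ht => ne_of_gt ht)).congr fun t => ?_
      simp [slope_def_field]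
    · rw [h.D_eq_zero x hx, inner_zero_left, mul_zero]
      refine tendsto_const_nhds.congr' ?_
      filter_upwards [self_mem_nhdsWithin] with t ht
      have htx : t • x ∉ Ω := fun h' => hx (StarConvex.mem_of_smul_mem h.star (le_of_lt ht) h')
      simp [h.u_eq_zero x hx, h.u_eq_zero _ htx]

/-- The divergence theorem for the radial vector fields `‖x‖ ^ β g(u) x`. -/
theorem integral_rpow_mul_deriv_mul_inner (h : ExtendedSolution μ Ω u D F) {β : ℝ} (hβ : 0 ≤ β)
    {g : ℝ → ℝ} (hg : ContDiff ℝ 1 g) (hg0 : g 0 = 0) :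
    ∫ x, ‖x‖ ^ β * (deriv g (u x) * inner ℝ (D x) x) ∂μ =
      -(Module.finrank ℝ E + β) * ∫ x, ‖x‖ ^ β * g (u x) ∂μ := by
  have hcont : Continuous fun x : E => ‖x‖ ^ β := continuous_norm.rpow_const fun _ => Or.inr hβ
  have hint : IntegrableOn (fun x : E => ‖x‖ ^ β) Ω μ :=
    (hcont.continuousOn.integrableOn_compact h.isBounded.isCompact_closure).mono_set
      subset_closure
  have h1 := h.tendsto_integral_dilation hint hcont.measurable hg
  set A := ∫ x, ‖x‖ ^ β * g (u x) ∂μ with hA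
  set d := Module.finrank ℝ E
  have hgu : BddIn Ω (fun x => g (u x)) := by
    obtain ⟨C, hC⟩ := h.isBounded.isCompact_closure.exists_bound_of_continuousOn
      (hg.continuous.comp h.continuous).continuousOn
    refine ⟨(hg.continuous.comp h.continuous).measurable,
      fun x hx => by simp [h.u_eq_zero x hx, hg0], |C|, fun x => ?_⟩
    by_cases hx : x ∈ Ω
    · exact (hC x (subset_closure hx)).trans (le_abs_self C)
    · simp [h.u_eq_zero x hx, hg0]
  have hscale : ∀ t : ℝ, 1 < t → ∫ x, ‖x‖ ^ β * ((g (u (t • x)) - g (u x)) / (t - 1)) ∂μ =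
      (t ^ (-(d + β)) * A - A) / (t - 1) := by
    intro t ht
    have ht0 : 0 < t := by linarith
    -- By homogeneity of the weight, the dilated integral is an explicit power of t times A. Its
    -- derivative at t = 1 gives the right side, so no divergence is ever taken.
    have e1 : ∫ x, ‖x‖ ^ β * g (u (t • x)) ∂μ = t ^ (-(d + β)) * A := by
      have h2 := Measure.integral_comp_smul μ (fun y : E => t ^ (-β) * (‖y‖ ^ β * g (u y))) t
      rw [integral_const_mul (t ^ (-β)) (fun y : E => ‖y‖ ^ β * g (u y)), smul_eq_mul,
        abs_of_pos (by positivity), ← hA] at h2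
      have h3 : t ^ (-((d : ℝ) + β)) = (t ^ d)⁻¹ * t ^ (-β) := by
        rw [neg_add, Real.rpow_add ht0, Real.rpow_neg ht0.le, Real.rpow_natCast]
      rw [h3, mul_assoc, ← h2]
      refine integral_congr_ae (Eventually.of_forall fun x => ?_)
      simp only [norm_smul, Real.norm_eq_abs, abs_of_pos ht0]
      rw [Real.mul_rpow ht0.le (norm_nonneg _), ← mul_assoc, ← mul_assoc, ← Real.rpow_add ht0]
      simp
    rw [← e1, hA, ← integral_sub, ← integral_div]
    · congr 1
      ext x
      ring
    · exact (BddIn.continuous_mul h.isBounded hcont (h.bddIn_of_smul ht.le hgu)).integrable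
        h.isBounded
    · exact (BddIn.continuous_mul h.isBounded hcont hgu).integrable h.isBounded
  have h2 : HasDerivAt (fun t : ℝ => t ^ (-(d + β)) * A) (-(d + β) * A) 1 := by
    simpa using ((Real.hasDerivAt_rpow_const (x := 1) (p := -(d + β))
      (Or.inl one_ne_zero)).mul_const A)
  refine tendsto_nhds_unique h1 ((h2.tendsto_slope.mono_left
    (nhdsWithin_mono _ fun t ht => ne_of_gt ht)).congr' ?_)
  filter_upwards [self_mem_nhdsWithin] with t ht
  rw [hscale t ht]
  simp [slope_def_field]

/-- The case of even powers of the norm and `g(u) = u ^ 2`. -/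
theorem integral_pow_mul_inner (h : ExtendedSolution μ Ω u D F) (j : ℕ) :
    2 * ∫ x, ‖x‖ ^ (2 * j) * (u x * inner ℝ (D x) x) ∂μ =
      -(Module.finrank ℝ E + 2 * j) * ∫ x, ‖x‖ ^ (2 * j) * u x ^ 2 ∂μ := by
  have h1 := h.integral_rpow_mul_deriv_mul_inner (β := ((2 * j : ℕ) : ℝ)) (by positivity)
    (g := fun s => s ^ 2) (contDiff_id.pow 2) (by simp)
  simp only [Real.rpow_natCast] at h1
  push_cast at h1
  rw [← h1, ← integral_const_mul]
  refine integral_congr_ae (Eventually.of_forall fun x => ?_)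
  simp
  ring

end ExtendedSolution

/-! ### Weighted energy identities and the one-sided Pohozaev inequality -/

theorem contDiff_norm_pow (j : ℕ) : ContDiff ℝ 1 (fun x : E => ‖x‖ ^ (2 * j)) := by
  simp_rw [pow_mul]
  exact (contDiff_norm_sq ℝ).pow j

theorem fderiv_norm_pow (j : ℕ) (x v : E) :
    fderiv ℝ (fun x : E => ‖x‖ ^ (2 * (j + 1))) x v =
      2 * (j + 1) * (‖x‖ ^ (2 * j) * inner ℝ v x) := by
  have h1 : HasFDerivAt (fun x : E => ‖x‖ ^ 2) (2 • innerSL ℝ x) x :=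
    (hasStrictFDerivAt_norm_sq x).hasFDerivAt
  have h2 := (h1.pow (j + 1)).fderiv
  simp_rw [pow_mul]
  rw [h2]
  simp [real_inner_comm]
  ring

namespace ExtendedSolution

variable {μ : Measure E} [μ.IsAddHaarMeasure] {Ω : Set E} {u : E → ℝ} {D : E → E} {F : E → ℝ}

/-- The weak equation tested with `ζ u`. -/
theorem weak_self (h : ExtendedSolution μ Ω u D F) (j : ℕ) :
    ∫ x, ‖x‖ ^ (2 * (j + 1)) * ‖D x‖ ^ 2 ∂μ +
      2 * (j + 1) * ∫ x, ‖x‖ ^ (2 * j) * (u x * inner ℝ (D x) x) ∂μ =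
      ∫ x, ‖x‖ ^ (2 * (j + 1)) * (F x * u x) ∂μ := by
  have h1 := h.weak_dilation (contDiff_norm_pow (j + 1)) le_rfl
  simp only [one_smul, one_mul, fderiv_norm_pow, real_inner_self_eq_norm_sq] at h1
  rw [← integral_const_mul, ← integral_add]
  · convert h1 using 2
    · ext x; ring
    · ext x; ring
  · exact (BddIn.continuous_mul h.isBounded (contDiff_norm_pow (j + 1)).continuous
      h.bddIn_norm_sq).integrable h.isBounded
  · exact ((BddIn.continuous_mul h.isBounded (contDiff_norm_pow j).continuous
      (h.bddIn_u.mul h.bddIn_inner)).const_mul _).integrable h.isBounded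

theorem energy_identity (h : ExtendedSolution μ Ω u D F) :
    ∫ x, ‖D x‖ ^ 2 ∂μ = ∫ x, F x * u x ∂μ := by
  have h1 := h.weak_dilation (ζ := fun _ => 1) contDiff_const le_rfl
  simpa using h1

/-- The variational inequality obtained by comparing `u` with its dilates in a weighted Dirichlet
energy. -/
theorem variational_inequality (h : ExtendedSolution μ Ω u D F) (j : ℕ) {R : ℝ}
    (hR : ∀ x ∈ Ω, ‖x‖ ≤ R) :
    ∫ x, ((R ^ (2 * (j + 1)) - ‖x‖ ^ (2 * (j + 1))) * (F x * inner ℝ (D x) x) +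
        2 * (j + 1) * (‖x‖ ^ (2 * j) * inner ℝ (D x) x ^ 2)) ∂μ ≤
      ((2 - Module.finrank ℝ E) * (R ^ (2 * (j + 1)) * ∫ x, ‖D x‖ ^ 2 ∂μ) -
        (2 - Module.finrank ℝ E - 2 * (j + 1)) *
          ∫ x, ‖x‖ ^ (2 * (j + 1)) * ‖D x‖ ^ 2 ∂μ) / 2 := by
  set C := R ^ (2 * (j + 1)) with hCdef
  set d := Module.finrank ℝ E
  set a := ∫ x, ‖D x‖ ^ 2 ∂μ with ha
  set b := ∫ x, ‖x‖ ^ (2 * (j + 1)) * ‖D x‖ ^ 2 ∂μ with hb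
  let ζ : E → ℝ := fun x => C - ‖x‖ ^ (2 * (j + 1))
  have hζ : ContDiff ℝ 1 ζ := contDiff_const.sub (contDiff_norm_pow (j + 1))
  have hζ0 : ∀ x ∈ Ω, 0 ≤ ζ x := fun x hx =>
    sub_nonneg.2 (pow_le_pow_left₀ (norm_nonneg _) (hR x hx) _)
  have hdζ : ∀ x v, fderiv ℝ ζ x v = -(2 * (j + 1) * (‖x‖ ^ (2 * j) * inner ℝ v x)) := by
    intro x v
    rw [← fderiv_norm_pow, show ζ = fun x => C - ‖x‖ ^ (2 * (j + 1)) from rfl, fderiv_const_sub]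
    simp
  -- With this density, `weak_dilation` says that ∫ w(x) u(tx) equals the weighted cross energy t ∫
  -- ζ ⟪D(tx), D(x)⟫, so the left side of the claim is a derivative in t of that cross energy.
  let w : E → ℝ := fun x => F x * ζ x - fderiv ℝ ζ x (D x)
  have hw : BddIn Ω w := by
    have h1 := (BddIn.continuous_mul h.isBounded hζ.continuous h.F_bddIn).add
      ((h.bddIn_fderiv_apply hζ).const_mul (-1))
    convert h1 using 2 with x
    simp only [w]
    ring
  have hlim := h.tendsto_integral_dilation (hw.integrable (μ := μ) h.isBounded).integrableOn
    hw.measurable (g := id) contDiff_id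
  -- Q(t) is half the difference between the ζ-weighted Dirichlet energies of u(t·) and u, in the
  -- closed form given by a change of variables.
  let Q : ℝ → ℝ := fun t =>
    ((t ^ d)⁻¹ * (t ^ 2 * (C * a) - t ^ 2 * (t ^ (2 * (j + 1)))⁻¹ * b) - (C * a - b)) / 2
  have hQ : HasDerivAt Q (((2 - d) * (C * a) - (2 - d - 2 * (j + 1)) * b) / 2) 1 := by
    have e1 : HasDerivAt (fun t : ℝ => (t ^ d)⁻¹) (-d) 1 := by
      simpa using (hasDerivAt_pow d (1 : ℝ)).fun_inv (by simp)
    have e2 : HasDerivAt (fun t : ℝ => t ^ 2) 2 1 := by simpa using hasDerivAt_pow 2 (1 : ℝ)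
    have e3 : HasDerivAt (fun t : ℝ => (t ^ (2 * (j + 1)))⁻¹) (-(2 * (j + 1))) 1 := by
      simpa using (hasDerivAt_pow (2 * (j + 1)) (1 : ℝ)).fun_inv (by simp)
    refine (((e1.mul ((e2.mul_const (C * a)).sub ((e2.mul e3).mul_const b))).sub_const
      (C * a - b)).div_const 2).congr_deriv ?_
    simp only [one_pow, inv_one, one_mul, Pi.sub_apply, Pi.mul_apply]
    ring
  have hQ1 : Q 1 = 0 := by simp [Q]
  have hslope := hQ.tendsto_slope.mono_left (nhdsWithin_mono _ fun t (ht : 1 < t) => ne_of_gt ht)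
  have hlim2 : ∫ x, w x * (deriv id (u x) * inner ℝ (D x) x) ∂μ =
      ∫ x, ((C - ‖x‖ ^ (2 * (j + 1))) * (F x * inner ℝ (D x) x) +
        2 * (j + 1) * (‖x‖ ^ (2 * j) * inner ℝ (D x) x ^ 2)) ∂μ := by
    refine integral_congr_ae (Eventually.of_forall fun x => ?_)
    simp only [w, hdζ, deriv_id, ζ]
    ring
  rw [← hlim2]
  refine le_of_tendsto_of_tendsto hlim hslope ?_
  filter_upwards [self_mem_nhdsWithin] with t ht
  have ht1 : (1 : ℝ) < t := ht
  have ht0 : 0 < t := by linarith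
  have hS := h.bddIn_norm_sq
  have hSt := h.bddIn_of_smul ht1.le hS
  have hut := h.bddIn_of_smul ht1.le h.bddIn_u
  have iS := BddIn.continuous_mul h.isBounded hζ.continuous hS
  have iSt := BddIn.continuous_mul h.isBounded hζ.continuous hSt
  have iX := BddIn.continuous_mul h.isBounded hζ.continuous (h.bddIn_inner_smul t)
  have iU := hut.mul (h.bddIn_fderiv_apply hζ)
  have iU1 := h.bddIn_u.mul (h.bddIn_fderiv_apply hζ)
  have iF := h.F_bddIn.mul (BddIn.continuous_mul h.isBounded hζ.continuous hut)
  have iF1 := h.F_bddIn.mul (BddIn.continuous_mul h.isBounded hζ.continuous h.bddIn_u)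
  have W := h.weak_dilation hζ ht1.le
  have W1 := h.weak_dilation hζ le_rfl
  simp only [one_smul, one_mul, real_inner_self_eq_norm_sq] at W1
  rw [integral_add ((iX.const_mul t).integrable h.isBounded) (iU.integrable h.isBounded)] at W
  rw [integral_add (iS.integrable h.isBounded) (iU1.integrable h.isBounded)] at W1
  have hsplit : ∫ x, w x * ((id (u (t • x)) - id (u x)) / (t - 1)) ∂μ =
      (∫ x, t * (ζ x * inner ℝ (D (t • x)) (D x)) ∂μ - ∫ x, ζ x * ‖D x‖ ^ 2 ∂μ) / (t - 1) := by
    have e1 : ∫ x, w x * (u (t • x) - u x) ∂μ =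
        ∫ x, F x * (ζ x * u (t • x)) ∂μ - ∫ x, u (t • x) * fderiv ℝ ζ x (D x) ∂μ -
        (∫ x, F x * (ζ x * u x) ∂μ - ∫ x, u x * fderiv ℝ ζ x (D x) ∂μ) := by
      rw [← integral_sub (iF.integrable h.isBounded) (iU.integrable h.isBounded),
        ← integral_sub (iF1.integrable h.isBounded) (iU1.integrable h.isBounded), ← integral_sub (f := fun x => F x * (ζ x * u (t • x)) - u (t • x) * fderiv ℝ ζ x (D x))
        (g := fun x => F x * (ζ x * u x) - u x * fderiv ℝ ζ x (D x))
        ((iF.integrable h.isBounded).sub (iU.integrable h.isBounded))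
        ((iF1.integrable h.isBounded).sub (iU1.integrable h.isBounded))]
      refine integral_congr_ae (Eventually.of_forall fun x => ?_)
      simp only [w]
      ring
    simp only [id, ← mul_div_assoc]
    rw [integral_div, e1]
    congr 1
    linarith
  -- Young's inequality bounds the cross energy by the mean of the two energies; ζ ≥ 0 on Ω is
  -- essential. Subtracting the energy of u leaves exactly Q(t).
  have hyoung : ∫ x, t * (ζ x * inner ℝ (D (t • x)) (D x)) ∂μ ≤
      ∫ x, (t ^ 2 / 2 * (ζ x * ‖D (t • x)‖ ^ 2) + 1 / 2 * (ζ x * ‖D x‖ ^ 2)) ∂μ := by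
    refine integral_mono ((iX.const_mul t).integrable h.isBounded)
      (((iSt.const_mul _).add (iS.const_mul _)).integrable h.isBounded) fun x => ?_
    by_cases hx : x ∈ Ω
    · have h1 := real_inner_le_norm (D (t • x)) (D x)
      have h2 : t * inner ℝ (D (t • x)) (D x) ≤
          t ^ 2 / 2 * ‖D (t • x)‖ ^ 2 + 1 / 2 * ‖D x‖ ^ 2 := by
        nlinarith [sq_nonneg (t * ‖D (t • x)‖ - ‖D x‖), mul_le_mul_of_nonneg_left h1 ht0.le]
      have := mul_le_mul_of_nonneg_left h2 (hζ0 x hx)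
      calc t * (ζ x * inner ℝ (D (t • x)) (D x)) = ζ x * (t * inner ℝ (D (t • x)) (D x)) := by ring
        _ ≤ _ := this
        _ = _ := by ring
    · have htx : t • x ∉ Ω := fun h' => hx (StarConvex.mem_of_smul_mem h.star ht1.le h')
      simp [h.D_eq_zero x hx, h.D_eq_zero _ htx]
  rw [integral_add ((iSt.const_mul _).integrable h.isBounded)
    ((iS.const_mul _).integrable h.isBounded), integral_const_mul (t ^ 2 / 2),
    integral_const_mul (1 / 2 : ℝ)] at hyoung
  have ip := (BddIn.continuous_mul h.isBounded (contDiff_norm_pow (j + 1)).continuous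
    hS).integrable (μ := μ) h.isBounded
  have hζS : ∫ x, ζ x * ‖D x‖ ^ 2 ∂μ = C * a - b := by
    rw [ha, hb, ← integral_const_mul, ← integral_sub ((hS.const_mul C).integrable h.isBounded) ip]
    refine integral_congr_ae (Eventually.of_forall fun x => ?_)
    simp only [ζ]
    ring
  have hζSt : ∫ x, ζ x * ‖D (t • x)‖ ^ 2 ∂μ =
      (t ^ d)⁻¹ * (C * a - (t ^ (2 * (j + 1)))⁻¹ * b) := by
    have h2 := Measure.integral_comp_smul μ (fun y : E =>
      C * ‖D y‖ ^ 2 - (t ^ (2 * (j + 1)))⁻¹ * (‖y‖ ^ (2 * (j + 1)) * ‖D y‖ ^ 2)) t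
    rw [integral_sub ((hS.const_mul C).integrable h.isBounded) (ip.const_mul _),
      integral_const_mul, integral_const_mul, smul_eq_mul, abs_of_pos (by positivity)] at h2
    rw [← h2]
    refine integral_congr_ae (Eventually.of_forall fun x => ?_)
    simp only [ζ, norm_smul, Real.norm_eq_abs, abs_of_pos ht0, mul_pow]
    field_simp
  rw [hsplit, slope_def_field, hQ1, sub_zero]
  refine div_le_div_of_nonneg_right ?_ (by linarith)
  rw [hζS] at hyoung ⊢
  rw [hζSt] at hyoung
  simp only [Q]
  linarith

end ExtendedSolution

/-! ### Carleman and Hardy inequalities, unique continuation -/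

namespace ExtendedSolution

variable {μ : Measure E} [μ.IsAddHaarMeasure] {Ω : Set E} {u : E → ℝ} {D : E → E} {F : E → ℝ}

theorem integral_mul_sq (h : ExtendedSolution μ Ω u D F) {p : E → ℝ} (hp : Continuous p) (c : ℝ) :
    ∫ x, p x * (inner ℝ (D x) x + c * u x) ^ 2 ∂μ =
      ∫ x, p x * inner ℝ (D x) x ^ 2 ∂μ + 2 * c * ∫ x, p x * (u x * inner ℝ (D x) x) ∂μ +
        c ^ 2 * ∫ x, p x * u x ^ 2 ∂μ := by
  have i3 := (BddIn.continuous_mul h.isBounded hp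
    (h.bddIn_inner.mul h.bddIn_inner)).integrable (μ := μ) h.isBounded
  have i4 := (BddIn.continuous_mul h.isBounded hp
    (h.bddIn_u.mul h.bddIn_inner)).integrable (μ := μ) h.isBounded
  have i5 := (BddIn.continuous_mul h.isBounded hp
    (h.bddIn_u.mul h.bddIn_u)).integrable (μ := μ) h.isBounded
  simp only [← sq] at i3 i5
  have i34 : Integrable (fun x => p x * inner ℝ (D x) x ^ 2 +
      2 * c * (p x * (u x * inner ℝ (D x) x))) μ := i3.add (i4.const_mul _)
  rw [← integral_const_mul, ← integral_const_mul, ← integral_add i3 (i4.const_mul _),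
    ← integral_add i34 (i5.const_mul _)]
  refine integral_congr_ae (Eventually.of_forall fun x => ?_)
  simp only
  ring

/-- Carleman-type inequality: a solution whose Pohozaev functional is nonpositive satisfies
`2m ∫ r^{2m-2} W² ≤ ∫ r^{2m} F W`, where `W = x·∇u + τ u`. -/
theorem carleman (h : ExtendedSolution μ Ω u D F)
    (hP : (2 - (Module.finrank ℝ E : ℝ)) / 2 * ∫ x, ‖D x‖ ^ 2 ∂μ ≤
      ∫ x, F x * inner ℝ (D x) x ∂μ) (j : ℕ) {τ : ℝ}
    (hτ : 2 * τ = Module.finrank ℝ E + 2 * j) :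
    2 * (j + 1) * ∫ x, ‖x‖ ^ (2 * j) * (inner ℝ (D x) x + τ * u x) ^ 2 ∂μ ≤
      ∫ x, ‖x‖ ^ (2 * (j + 1)) * (F x * (inner ℝ (D x) x + τ * u x)) ∂μ := by
  obtain ⟨R, hR0, hR⟩ := h.exists_bound
  have hV := h.variational_inequality j hR
  have hS := h.weak_self j
  have hI := h.integral_pow_mul_inner j
  have hp : ∀ i : ℕ, Continuous fun x : E => ‖x‖ ^ (2 * i) := fun i =>
    (contDiff_norm_pow i).continuous
  have i1 := (h.F_bddIn.mul h.bddIn_inner).integrable (μ := μ) h.isBounded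
  have i2 := (BddIn.continuous_mul h.isBounded (hp (j + 1))
    (h.F_bddIn.mul h.bddIn_inner)).integrable (μ := μ) h.isBounded
  have i3 := (BddIn.continuous_mul h.isBounded (hp j)
    (h.bddIn_inner.mul h.bddIn_inner)).integrable (μ := μ) h.isBounded
  have i6 := (BddIn.continuous_mul h.isBounded (hp (j + 1))
    (h.F_bddIn.mul h.bddIn_u)).integrable (μ := μ) h.isBounded
  simp only [← sq] at i3
  set C := R ^ (2 * (j + 1))
  have hC : 0 ≤ C := by positivity
  have e1 : ∫ x, ((C - ‖x‖ ^ (2 * (j + 1))) * (F x * inner ℝ (D x) x) +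
        2 * (j + 1) * (‖x‖ ^ (2 * j) * inner ℝ (D x) x ^ 2)) ∂μ =
      C * ∫ x, F x * inner ℝ (D x) x ∂μ -
        ∫ x, ‖x‖ ^ (2 * (j + 1)) * (F x * inner ℝ (D x) x) ∂μ +
        2 * (j + 1) * ∫ x, ‖x‖ ^ (2 * j) * inner ℝ (D x) x ^ 2 ∂μ := by
    have i12 : Integrable (fun x => C * (F x * inner ℝ (D x) x) -
        ‖x‖ ^ (2 * (j + 1)) * (F x * inner ℝ (D x) x)) μ := (i1.const_mul C).sub i2
    rw [← integral_const_mul, ← integral_const_mul, ← integral_sub (i1.const_mul C) i2,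
      ← integral_add i12 (i3.const_mul _)]
    refine integral_congr_ae (Eventually.of_forall fun x => ?_)
    simp only
    ring
  have e2 := h.integral_mul_sq (hp j) τ
  have e3 : ∫ x, ‖x‖ ^ (2 * (j + 1)) * (F x * (inner ℝ (D x) x + τ * u x)) ∂μ =
      ∫ x, ‖x‖ ^ (2 * (j + 1)) * (F x * inner ℝ (D x) x) ∂μ +
        τ * ∫ x, ‖x‖ ^ (2 * (j + 1)) * (F x * u x) ∂μ := by
    rw [← integral_const_mul, ← integral_add i2 (i6.const_mul _)]
    refine integral_congr_ae (Eventually.of_forall fun x => ?_)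
    simp only
    ring
  rw [e1] at hV
  rw [e2, e3, ← hS]
  -- Multiplied by C, the sign of the Pohozaev functional cancels every term of the variational
  -- inequality that contains R.
  have hCP := mul_le_mul_of_nonneg_left hP hC
  rw [← hτ] at hI
  have hd : (Module.finrank ℝ E : ℝ) = 2 * τ - 2 * j := by linarith
  rw [hd] at hV hCP
  -- This makes the cross term −τ∫|x|^{2j}u², so completing the square yields ∫|x|^{2j}W² =
  -- ∫|x|^{2j}(x·∇u)² + τ∫|x|^{2j}u(x·∇u), the combination left after eliminating the weighted
  -- energy.
  have hI' : ∫ x, ‖x‖ ^ (2 * j) * (u x * inner ℝ (D x) x) ∂μ =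
      -τ * ∫ x, ‖x‖ ^ (2 * j) * u x ^ 2 ∂μ := by linarith
  rw [hI'] at hS ⊢
  linarith

/-- A Hardy-type inequality. -/
theorem hardy (h : ExtendedSolution μ Ω u D F) (j : ℕ) {τ : ℝ}
    (hτ : 2 * τ = Module.finrank ℝ E + 2 * j) :
    4 * ∫ x, ‖x‖ ^ (2 * (j + 2)) * u x ^ 2 ∂μ ≤
      ∫ x, ‖x‖ ^ (2 * (j + 2)) * (inner ℝ (D x) x + τ * u x) ^ 2 ∂μ := by
  have hI := h.integral_pow_mul_inner (j + 2)
  have hp : Continuous fun x : E => ‖x‖ ^ (2 * (j + 2)) := (contDiff_norm_pow (j + 2)).continuous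
  have e := h.integral_mul_sq hp
  -- For the weight of exponent 2(j+2) the cross term is −(τ+2)∫|x|^{2(j+2)}u², so τ+2 is the
  -- optimal shift. Moving from τ+2 back to τ adds (τ+2−τ)² = 4 times the weighted norm of u.
  have hpos : 0 ≤ ∫ x, ‖x‖ ^ (2 * (j + 2)) * (inner ℝ (D x) x + (τ + 2) * u x) ^ 2 ∂μ :=
    integral_nonneg fun x => by
      have : 0 ≤ ‖x‖ := norm_nonneg x
      simp only [Pi.zero_apply]
      positivity
  rw [e] at hpos ⊢
  have hd : (Module.finrank ℝ E : ℝ) = 2 * τ - 2 * j := by linarith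
  push_cast at hI
  rw [hd] at hI
  have hI' : ∫ x, ‖x‖ ^ (2 * (j + 2)) * (u x * inner ℝ (D x) x) ∂μ =
      -(τ + 2) * ∫ x, ‖x‖ ^ (2 * (j + 2)) * u x ^ 2 ∂μ := by linarith
  rw [hI'] at hpos ⊢
  linarith

/-- Unique continuation: a solution of `|Δu| ≤ M|u|` with nonpositive Pohozaev functional is
trivial. -/
theorem eq_zero (h : ExtendedSolution μ Ω u D F) [Nontrivial E] {M : ℝ} (hM : 0 ≤ M)
    (hF : ∀ x, |F x| ≤ M * |u x|)
    (hP : (2 - (Module.finrank ℝ E : ℝ)) / 2 * ∫ x, ‖D x‖ ^ 2 ∂μ ≤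
      ∫ x, F x * inner ℝ (D x) x ∂μ) : u = 0 := by
  obtain ⟨R, hR0, hR⟩ := h.exists_bound
  -- With Q and V the weighted norms below, Carleman and Young give 2(j+1)Q ≤ (M/2)(V+Q), while
  -- Hardy gives V ≤ (R⁴/4)Q. Hence 2(j+1)Q ≤ (M/2)(R⁴/4+1)Q, which this choice of j contradicts
  -- unless Q = 0.
  obtain ⟨j, hj⟩ := exists_nat_gt (M / 4 * (R ^ 4 / 4 + 1))
  set τ : ℝ := (Module.finrank ℝ E + 2 * j) / 2 with hτdef
  have hτ : 2 * τ = Module.finrank ℝ E + 2 * j := by rw [hτdef]; ring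
  have hC := h.carleman hP j hτ
  have hH := h.hardy j hτ
  let W : E → ℝ := fun x => inner ℝ (D x) x + τ * u x
  have hW : BddIn Ω W := h.bddIn_inner.add (h.bddIn_u.const_mul τ)
  have hp : ∀ i : ℕ, Continuous fun x : E => ‖x‖ ^ (2 * i) := fun i =>
    (contDiff_norm_pow i).continuous
  have i1 := (BddIn.continuous_mul h.isBounded (hp j) (hW.mul hW)).integrable (μ := μ) h.isBounded
  have i2 := (BddIn.continuous_mul h.isBounded (hp (j + 2)) (hW.mul hW)).integrable (μ := μ)
    h.isBounded
  have i3 := (BddIn.continuous_mul h.isBounded (hp (j + 2))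
    (h.bddIn_u.mul h.bddIn_u)).integrable (μ := μ) h.isBounded
  have i4 := (BddIn.continuous_mul h.isBounded (hp (j + 1)) (h.F_bddIn.mul hW)).integrable
    (μ := μ) h.isBounded
  simp only [← sq] at i1 i2 i3
  change 2 * (j + 1) * ∫ x, ‖x‖ ^ (2 * j) * W x ^ 2 ∂μ ≤
    ∫ x, ‖x‖ ^ (2 * (j + 1)) * (F x * W x) ∂μ at hC
  change _ ≤ ∫ x, ‖x‖ ^ (2 * (j + 2)) * W x ^ 2 ∂μ at hH
  have h1 : ∫ x, ‖x‖ ^ (2 * (j + 2)) * W x ^ 2 ∂μ ≤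
      R ^ 4 * ∫ x, ‖x‖ ^ (2 * j) * W x ^ 2 ∂μ := by
    rw [← integral_const_mul]
    refine integral_mono i2 (i1.const_mul _) fun x => ?_
    by_cases hx : x ∈ Ω
    · have h4 : ‖x‖ ^ 4 ≤ R ^ 4 := pow_le_pow_left₀ (norm_nonneg _) (hR x hx) 4
      have h5 : 0 ≤ ‖x‖ ^ (2 * j) * W x ^ 2 := by positivity
      calc ‖x‖ ^ (2 * (j + 2)) * W x ^ 2 = ‖x‖ ^ 4 * (‖x‖ ^ (2 * j) * W x ^ 2) := by ring
        _ ≤ R ^ 4 * (‖x‖ ^ (2 * j) * W x ^ 2) := mul_le_mul_of_nonneg_right h4 h5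
    · simp [hW.eq_zero x hx]
  have h2 : ∫ x, ‖x‖ ^ (2 * (j + 1)) * (F x * W x) ∂μ ≤
      M / 2 * ∫ x, ‖x‖ ^ (2 * (j + 2)) * u x ^ 2 ∂μ +
      M / 2 * ∫ x, ‖x‖ ^ (2 * j) * W x ^ 2 ∂μ := by
    rw [← integral_const_mul, ← integral_const_mul,
      ← integral_add (i3.const_mul _) (i1.const_mul _)]
    refine integral_mono i4 ((i3.const_mul _).add (i1.const_mul _)) fun x => ?_
    have h3 : F x * W x ≤ M * (|u x| * |W x|) :=
      (le_abs_self _).trans (by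
        rw [abs_mul, ← mul_assoc]
        exact mul_le_mul_of_nonneg_right (hF x) (abs_nonneg _))
    -- The factor |x|² is attached to u: the weight of exponent 2(j+1) is the geometric mean of
    -- those in Hardy (2(j+2)) and Carleman (2j).
    have h4 : 2 * (‖x‖ ^ 2 * |u x| * |W x|) ≤ ‖x‖ ^ 4 * u x ^ 2 + W x ^ 2 := by
      have := sq_nonneg (‖x‖ ^ 2 * |u x| - |W x|)
      have e1 := sq_abs (u x)
      have e2 := sq_abs (W x)
      calc 2 * (‖x‖ ^ 2 * |u x| * |W x|) ≤ ‖x‖ ^ 4 * |u x| ^ 2 + |W x| ^ 2 := by linarith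
        _ = _ := by rw [e1, e2]
    calc ‖x‖ ^ (2 * (j + 1)) * (F x * W x) ≤ ‖x‖ ^ (2 * (j + 1)) * (M * (|u x| * |W x|)) :=
          mul_le_mul_of_nonneg_left h3 (by positivity)
      _ = M / 2 * ‖x‖ ^ (2 * j) * (2 * (‖x‖ ^ 2 * |u x| * |W x|)) := by ring
      _ ≤ M / 2 * ‖x‖ ^ (2 * j) * (‖x‖ ^ 4 * u x ^ 2 + W x ^ 2) :=
          mul_le_mul_of_nonneg_left h4 (by positivity)
      _ = _ := by ring
  have hnn : ∀ x, 0 ≤ ‖x‖ ^ (2 * (j + 2)) * u x ^ 2 := fun x => by positivity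
  set Q := ∫ x, ‖x‖ ^ (2 * j) * W x ^ 2 ∂μ with hQ
  set V := ∫ x, ‖x‖ ^ (2 * (j + 2)) * u x ^ 2 ∂μ with hV
  have hQ0 : 0 ≤ Q := integral_nonneg fun x => by
    simp only [Pi.zero_apply]
    positivity
  have hV0 : 0 ≤ V := integral_nonneg hnn
  have hVQ : V ≤ R ^ 4 / 4 * Q := by linarith
  have hMV := mul_le_mul_of_nonneg_left hVQ (by positivity : 0 ≤ M / 2)
  have hQle : Q ≤ 0 := by
    by_contra hQpos
    rw [not_le] at hQpos
    have := mul_lt_mul_of_pos_right hj hQpos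
    nlinarith
  have hVz : V = 0 := by
    have : Q = 0 := le_antisymm hQle hQ0
    rw [this, mul_zero] at hVQ
    exact le_antisymm hVQ hV0
  rw [hV, integral_eq_zero_iff_of_nonneg hnn i3] at hVz
  refine (h.continuous.ae_eq_iff_eq μ continuous_zero).1 ?_
  have hne : ∀ᵐ x ∂μ, x ≠ 0 := by
    rw [ae_iff]
    simp
  filter_upwards [hVz, hne] with x hx hx0
  have hx' : ‖x‖ ^ (2 * (j + 2)) * u x ^ 2 = 0 := hx
  simpa [hx0] using hx'

end ExtendedSolution

end

/-! ### The power nonlinearity and the sign of its Pohozaev functional -/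

theorem abs_rpow_mul_self_mul_self {p : ℝ} (hp : 1 < p) (s : ℝ) :
    |s| ^ (p - 2) * s * s = |s| ^ p := by
  rcases eq_or_ne s 0 with rfl | hs
  · simp [Real.zero_rpow (by linarith : p ≠ 0)]
  · rw [mul_assoc, ← sq, ← sq_abs, ← Real.rpow_natCast, ← Real.rpow_add (abs_pos.2 hs)]
    norm_num

theorem contDiff_abs_rpow {p : ℝ} (hp : 1 < p) : ContDiff ℝ 1 (fun s : ℝ => |s| ^ p) :=
  contDiff_norm_rpow hp

theorem deriv_abs_rpow {p : ℝ} (hp : 1 < p) (s : ℝ) :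
    deriv (fun s : ℝ => |s| ^ p) s = p * (|s| ^ (p - 2) * s) := by
  rw [(hasDerivAt_abs_rpow s hp).deriv, mul_assoc]

/-- The sign condition on the coefficient in the Pohozaev identity. -/
theorem coefficient_nonpos {n lam β q : ℝ} (hn : 2 < n) (hq : 1 ≤ q)
    (hcases : (q ≤ (2 * β + n + 2) / (n - 2) ∧ lam ≤ 0) ∨
      ((2 * β + n + 2) / (n - 2) ≤ q ∧ 0 ≤ lam) ∨ (β = 0 ∧ q = (n + 2) / (n - 2))) :
    lam * ((n + β) / (q + 1) - (n - 2) / 2) ≤ 0 := by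
  have hn2 : 0 < n - 2 := by linarith
  have hq1 : 0 < q + 1 := by linarith
  have key : (n + β) / (q + 1) - (n - 2) / 2 =
      (2 * β + n + 2 - q * (n - 2)) / (2 * (q + 1)) := by
    field_simp
    ring
  rw [key]
  rcases hcases with ⟨h1, h2⟩ | ⟨h1, h2⟩ | ⟨h1, h2⟩
  · rw [le_div_iff₀ hn2] at h1
    exact mul_nonpos_of_nonpos_of_nonneg h2 (div_nonneg (by linarith) (by linarith))
  · rw [div_le_iff₀ hn2] at h1
    exact mul_nonpos_of_nonneg_of_nonpos h2
      (div_nonpos_of_nonpos_of_nonneg (by linarith) (by linarith))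
  · rw [eq_div_iff hn2.ne'] at h2
    rw [h1, h2]
    simp

section Nonlinearity

variable {E : Type*} [NormedAddCommGroup E] [InnerProductSpace ℝ E]

/-- The right-hand side `|t|^{p-2} t + lam |x|^β |t|^{q-1} t`. -/
noncomputable def nonlinearity (p lam β q : ℝ) (x : E) (t : ℝ) : ℝ :=
  |t| ^ (p - 2) * t + lam * ‖x‖ ^ β * (|t| ^ (q - 1) * t)

variable {p lam β q : ℝ}

theorem continuous_nonlinearity_comp (hp : 2 ≤ p) (hβ : 0 ≤ β) (hq : 1 ≤ q) {u : E → ℝ}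
    (hu : Continuous u) : Continuous fun x => nonlinearity p lam β q x (u x) := by
  unfold nonlinearity
  refine ((hu.abs.rpow_const fun _ => Or.inr (by linarith)).mul hu).add
    ((continuous_const.mul (continuous_norm.rpow_const fun _ => Or.inr hβ)).mul
      ((hu.abs.rpow_const fun _ => Or.inr (by linarith)).mul hu))

/-- Both powers are at least linear, so on a bounded range of x and t the nonlinearity is dominated
by a multiple of |t|, as unique continuation requires. -/
theorem abs_nonlinearity_le (hp : 2 ≤ p) (hβ : 0 ≤ β) (hq : 1 ≤ q) {x : E} {t R U : ℝ}
    (hx : ‖x‖ ≤ R) (ht : |t| ≤ U) :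
    |nonlinearity p lam β q x t| ≤ (U ^ (p - 2) + |lam| * R ^ β * U ^ (q - 1)) * |t| := by
  have h1 : |t| ^ (p - 2) ≤ U ^ (p - 2) :=
    Real.rpow_le_rpow (abs_nonneg _) ht (by linarith)
  have h2 : |t| ^ (q - 1) ≤ U ^ (q - 1) :=
    Real.rpow_le_rpow (abs_nonneg _) ht (by linarith)
  have h3 : ‖x‖ ^ β ≤ R ^ β := Real.rpow_le_rpow (norm_nonneg _) hx hβ
  have hR : 0 ≤ R ^ β := Real.rpow_nonneg ((norm_nonneg _).trans hx) _
  refine (abs_add_le _ _).trans ?_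
  rw [abs_mul, abs_mul, abs_mul, abs_mul, abs_of_nonneg (Real.rpow_nonneg (abs_nonneg t) _),
    abs_of_nonneg (Real.rpow_nonneg (abs_nonneg t) _),
    abs_of_nonneg (Real.rpow_nonneg (norm_nonneg x) _), add_mul, ← mul_assoc (|lam| * ‖x‖ ^ β)]
  gcongr

/-- The Pohozaev functional of a solution is nonpositive. -/
theorem ExtendedSolution.pohozaev [FiniteDimensional ℝ E] [MeasurableSpace E] [BorelSpace E]
    {μ : Measure E} [μ.IsAddHaarMeasure] {Ω : Set E} {u : E → ℝ} {D : E → E}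
    (h : ExtendedSolution μ Ω u D fun x => nonlinearity p lam β q x (u x))
    (hd : 2 < (Module.finrank ℝ E : ℝ))
    (hp : p = 2 * (Module.finrank ℝ E : ℝ) / ((Module.finrank ℝ E : ℝ) - 2))
    (hβ : 0 ≤ β) (hq : 1 ≤ q)
    (hcoef : lam * (((Module.finrank ℝ E : ℝ) + β) / (q + 1) -
      ((Module.finrank ℝ E : ℝ) - 2) / 2) ≤ 0) :
    (2 - (Module.finrank ℝ E : ℝ)) / 2 * ∫ x, ‖D x‖ ^ 2 ∂μ ≤
      ∫ x, nonlinearity p lam β q x (u x) * inner ℝ (D x) x ∂μ := by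
  set d : ℝ := (Module.finrank ℝ E : ℝ) with hddef
  have hd2 : 0 < d - 2 := by linarith
  have hp2 : 2 < p := by
    rw [hp, lt_div_iff₀ hd2]
    linarith
  have hp1 : 1 < p := by linarith
  have hq2 : 1 < q + 1 := by linarith
  have H1 := h.integral_rpow_mul_deriv_mul_inner le_rfl (contDiff_abs_rpow hp1)
    (by simp [Real.zero_rpow (by linarith : p ≠ 0)])
  have H2 := h.integral_rpow_mul_deriv_mul_inner hβ (contDiff_abs_rpow hq2)
    (by simp [Real.zero_rpow (by linarith : q + 1 ≠ 0)])
  simp only [deriv_abs_rpow hp1, Real.rpow_zero, one_mul, add_zero] at H1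
  simp only [deriv_abs_rpow hq2] at H2
  rw [show q + 1 - 2 = q - 1 by ring] at H2
  have hc : Continuous fun x : E => ‖x‖ ^ β := continuous_norm.rpow_const fun _ => Or.inr hβ
  have bc : ∀ {r : ℝ}, 0 ≤ r → BddIn Ω (fun x => |u x| ^ r * u x) := fun hr =>
    BddIn.continuous_mul h.isBounded
      (h.continuous.abs.rpow_const fun _ => Or.inr hr) h.bddIn_u
  have b1 : BddIn Ω (fun x => |u x| ^ (p - 2) * u x) := bc (by linarith)
  have b2 : BddIn Ω (fun x => ‖x‖ ^ β * (|u x| ^ (q - 1) * u x)) :=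
    BddIn.continuous_mul h.isBounded hc (bc (by linarith))
  have e1 : ∫ x, nonlinearity p lam β q x (u x) * u x ∂μ =
      ∫ x, |u x| ^ p ∂μ + lam * ∫ x, ‖x‖ ^ β * |u x| ^ (q + 1) ∂μ := by
    have i1 := (b1.mul h.bddIn_u).integrable (μ := μ) h.isBounded
    have i2 := (b2.mul h.bddIn_u).integrable (μ := μ) h.isBounded
    have j1 : ∀ x, |u x| ^ p = |u x| ^ (p - 2) * u x * u x := fun x =>
      (abs_rpow_mul_self_mul_self hp1 _).symm
    have j2 : ∀ x, ‖x‖ ^ β * |u x| ^ (q + 1) = ‖x‖ ^ β * (|u x| ^ (q - 1) * u x) * u x := by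
      intro x
      rw [← abs_rpow_mul_self_mul_self hq2, show q + 1 - 2 = q - 1 by ring]
      ring
    simp only [j1, j2]
    rw [← integral_const_mul, ← integral_add i1 (i2.const_mul _)]
    refine integral_congr_ae (Eventually.of_forall fun x => ?_)
    simp only [nonlinearity]
    ring
  have e2 : ∫ x, nonlinearity p lam β q x (u x) * inner ℝ (D x) x ∂μ =
      p⁻¹ * ∫ x, p * (|u x| ^ (p - 2) * u x) * inner ℝ (D x) x ∂μ +
        lam / (q + 1) * ∫ x, ‖x‖ ^ β * ((q + 1) * (|u x| ^ (q - 1) * u x) * inner ℝ (D x) x) ∂μ := by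
    have i1 := (b1.mul h.bddIn_inner).integrable (μ := μ) h.isBounded
    have i2 := (b2.mul h.bddIn_inner).integrable (μ := μ) h.isBounded
    have k1 : ∫ x, p * (|u x| ^ (p - 2) * u x) * inner ℝ (D x) x ∂μ =
        p * ∫ x, |u x| ^ (p - 2) * u x * inner ℝ (D x) x ∂μ := by
      simp only [mul_assoc p]
      rw [integral_const_mul]
    have k2 : ∫ x, ‖x‖ ^ β * ((q + 1) * (|u x| ^ (q - 1) * u x) * inner ℝ (D x) x) ∂μ =
        (q + 1) * ∫ x, ‖x‖ ^ β * (|u x| ^ (q - 1) * u x) * inner ℝ (D x) x ∂μ := by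
      rw [← integral_const_mul]
      congr 1
      ext x
      ring
    rw [k1, k2, inv_mul_cancel_left₀ (by linarith), ← mul_assoc,
      div_mul_cancel₀ _ (by linarith), ← integral_const_mul, ← integral_add i1 (i2.const_mul _)]
    refine integral_congr_ae (Eventually.of_forall fun x => ?_)
    simp only [nonlinearity]
    ring
  rw [h.energy_identity, e1, e2, H1, H2]
  set A := ∫ x, |u x| ^ p ∂μ
  set B := ∫ x, ‖x‖ ^ β * |u x| ^ (q + 1) ∂μ with hB
  have hB0 : 0 ≤ B := integral_nonneg fun x =>
    mul_nonneg (Real.rpow_nonneg (norm_nonneg _) _) (Real.rpow_nonneg (abs_nonneg _) _)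
  -- Criticality: d/p = (d−2)/2, so the A terms on the two sides cancel and only the multiple of B
  -- remains.
  have hpd : p⁻¹ * (-d * A) = -((d - 2) / 2) * A := by
    have : d ≠ 0 := by linarith
    rw [hp]
    field_simp
  have := mul_nonpos_of_nonpos_of_nonneg hcoef hB0
  rw [hpd]
  have e3 : lam / (q + 1) * (-(d + β) * B) = -(lam * ((d + β) / (q + 1)) * B) := by ring
  rw [e3]
  linarith

end Nonlinearity

/-! ### Application to the Dirichlet problems -/

/-- Zero boundary values make the extension continuous, the continuous extension of the gradient to
the compact closure bounds it, and `hf0` makes the right-hand side vanish off Ω. -/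
theorem IsDirichletSolution.extendedSolution {N : ℕ} {Ω : Set (EuclideanSpace ℝ (Fin N))}
    (hΩ : IsOpen Ω) (hΩb : Bornology.IsBounded Ω) (hstar : StarConvex ℝ 0 Ω)
    {f : EuclideanSpace ℝ (Fin N) → ℝ → ℝ} {u : EuclideanSpace ℝ (Fin N) → ℝ}
    (hu : IsDirichletSolution Ω f u) (hf0 : ∀ x, f x 0 = 0)
    (hf : Continuous fun x => f x (Ω.indicator u x)) :
    ExtendedSolution volume Ω (Ω.indicator u) (Ω.indicator (gradient u))
      (fun x => f x (Ω.indicator u x)) := by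
  obtain ⟨G, hG, hGu⟩ := hu.isC1.gradient_extends
  have hcl : IsCompact (closure Ω) := hΩb.isCompact_closure
  have hcont : Continuous (Ω.indicator u) := continuous_indicator hu.boundary hu.isC1.continuousOn
  refine ⟨hΩ, hΩb, hstar, hcont, fun x hx => indicator_of_notMem hx _,
    fun x hx => indicator_of_notMem hx _, fun x hx => ?_, ?_, ?_, ⟨hf.measurable, fun x hx => ?_, ?_⟩,
    fun φ hφ hφc hφΩ => ?_⟩
  · have h1 : DifferentiableAt ℝ u x :=
      (hu.isC1.contDiffOn.differentiableOn one_ne_zero).differentiableAt (hΩ.mem_nhds hx)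
    have h2 := h1.hasGradientAt.hasFDerivAt
    rw [indicator_of_mem hx]
    refine h2.congr_of_eventuallyEq ?_
    filter_upwards [hΩ.mem_nhds hx] with y hy
    exact indicator_of_mem hy _
  · refine (hG.mono subset_closure).congr fun x hx => ?_
    rw [indicator_of_mem hx, hGu x hx]
  · obtain ⟨K, hK⟩ := hcl.exists_bound_of_continuousOn hG
    refine ⟨|K|, fun x => ?_⟩
    by_cases hx : x ∈ Ω
    · rw [indicator_of_mem hx, ← hGu x hx]
      exact (hK x (subset_closure hx)).trans (le_abs_self K)
    · simp [hx]
  · simp only [indicator_of_notMem hx, hf0]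
  · obtain ⟨K, hK⟩ := hcl.exists_bound_of_continuousOn hf.continuousOn
    refine ⟨|K|, fun x => ?_⟩
    by_cases hx : x ∈ Ω
    · exact (hK x (subset_closure hx)).trans (le_abs_self K)
    · simp [hx, hf0]
  · have h1 := hu.weak φ hφ hφc hφΩ
    rw [← integral_indicator hΩ.measurableSet, ← integral_indicator hΩ.measurableSet] at h1
    refine Eq.trans (integral_congr_ae (Eventually.of_forall fun x => ?_)) (h1.trans
      (integral_congr_ae (Eventually.of_forall fun x => ?_)))
    · by_cases hx : x ∈ Ω
      · simp only [indicator_of_mem hx]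
        rw [real_inner_comm, inner_gradient_left]
      · simp [hx]
    · by_cases hx : x ∈ Ω
      · simp [hx]
      · simp [hx, hf0]

theorem not_isNontrivialSolution {N : ℕ} (hN : 3 ≤ N) {lam β q : ℝ} (hβ : 0 ≤ β) (hq : 1 ≤ q)
    (hcases :
      (q ≤ (2 * β + (N : ℝ) + 2) / ((N : ℝ) - 2) ∧ lam ≤ 0) ∨
      ((2 * β + (N : ℝ) + 2) / ((N : ℝ) - 2) ≤ q ∧ 0 ≤ lam) ∨
      (β = 0 ∧ q = ((N : ℝ) + 2) / ((N : ℝ) - 2)))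
    {Ω : Set (EuclideanSpace ℝ (Fin N))} (hΩ : IsOpen Ω) (hΩb : Bornology.IsBounded Ω)
    (hstar : StarConvex ℝ 0 Ω) (u : EuclideanSpace ℝ (Fin N) → ℝ) :
    ¬ IsNontrivialSolution Ω lam β q u := by
  rintro ⟨hu, x₀, hx₀, hux₀⟩
  have hN3 : (3 : ℝ) ≤ N := by exact_mod_cast hN
  have hp2 : 2 ≤ sobolevExp N := by
    rw [sobolevExp, le_div_iff₀ (by linarith)]
    linarith
  have : Nonempty (Fin N) := ⟨⟨0, by omega⟩⟩
  have hrank : (Module.finrank ℝ (EuclideanSpace ℝ (Fin N)) : ℝ) = N := by simp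
  have hcont : Continuous (Ω.indicator u) := continuous_indicator hu.boundary hu.isC1.continuousOn
  have h : ExtendedSolution volume Ω (Ω.indicator u) (Ω.indicator (gradient u))
      (fun x => nonlinearity (sobolevExp N) lam β q x (Ω.indicator u x)) :=
    IsDirichletSolution.extendedSolution hΩ hΩb hstar hu (fun x => by simp [nonlinearity])
      (continuous_nonlinearity_comp hp2 hβ hq hcont)
  have hP := h.pohozaev (by rw [hrank]; linarith) (by rw [hrank, sobolevExp]) hβ hq
    (by rw [hrank]; exact coefficient_nonpos (by linarith) hq hcases)
  obtain ⟨R, hR0, hR⟩ := h.exists_bound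
  obtain ⟨U, hU⟩ := h.bddIn_u.bound
  have hU0 : 0 ≤ U := (abs_nonneg _).trans (hU 0)
  have hz := h.eq_zero (M := U ^ (sobolevExp N - 2) + |lam| * R ^ β * U ^ (q - 1))
    (by positivity) (fun x => ?_) hP
  · have h0 := congrFun hz x₀
    rw [indicator_of_mem hx₀] at h0
    exact hux₀ h0
  · by_cases hx : x ∈ Ω
    · exact abs_nonlinearity_le hp2 hβ hq (hR x hx) (hU x)
    · simp [hx, nonlinearity]

/-- Where u > 0 the two right-hand sides coincide, since 2* − 1 = (N+2)/(N−2), and the weak equation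
only sees values in Ω. -/
theorem isNontrivialSolution_of_isPositiveSolution {N : ℕ} (hN : 3 ≤ N) {lam β q : ℝ}
    {Ω : Set (EuclideanSpace ℝ (Fin N))} (hΩ : IsOpen Ω) (hne : Ω.Nonempty)
    {u : EuclideanSpace ℝ (Fin N) → ℝ} (hu : IsPositiveSolution Ω lam β q u) :
    IsNontrivialSolution Ω lam β q u := by
  obtain ⟨hu, hpos⟩ := hu
  obtain ⟨x₀, hx₀⟩ := hne
  have hN3 : (3 : ℝ) ≤ N := by exact_mod_cast hN
  have hmul : ∀ {t r : ℝ}, 0 < t → |t| ^ (r - 1) * t = t ^ r := by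
    intro t r ht
    rw [abs_of_pos ht, Real.rpow_sub_one ht.ne', div_mul_cancel₀ _ ht.ne']
  have hexp : sobolevExp N - 2 = ((N : ℝ) + 2) / ((N : ℝ) - 2) - 1 := by
    have : (N : ℝ) - 2 ≠ 0 := by linarith
    rw [sobolevExp]
    field_simp
    ring
  refine ⟨⟨hu.isC1, hu.boundary, fun φ hφ hφc hφΩ => ?_⟩, x₀, hx₀, (hpos x₀ hx₀).ne'⟩
  rw [hu.weak φ hφ hφc hφΩ]
  refine setIntegral_congr_fun hΩ.measurableSet fun x hx => ?_
  have hx0 := hpos x hx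
  rw [hexp, hmul hx0, hmul hx0, max_eq_left hx0.le, mul_assoc]

end Pohozaev

theorem theorem1p2 (N : ℕ) (hN : 3 ≤ N) (lam β q : ℝ) (hβ : 0 ≤ β) (hq : 1 ≤ q)
    (hcases :
      (q ≤ (2 * β + (N : ℝ) + 2) / ((N : ℝ) - 2) ∧ lam ≤ 0) ∨
      ((2 * β + (N : ℝ) + 2) / ((N : ℝ) - 2) ≤ q ∧ 0 ≤ lam) ∨
      (β = 0 ∧ q = ((N : ℝ) + 2) / ((N : ℝ) - 2))) :
    (¬ ∃ u : EuclideanSpace ℝ (Fin N) → ℝ,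
        IsPositiveSolution (Metric.ball (0 : EuclideanSpace ℝ (Fin N)) 1) lam β q u) ∧
    (∀ Ω : Set (EuclideanSpace ℝ (Fin N)), IsBoundedSmoothDomain Ω → StarConvex ℝ 0 Ω →
      (¬ ∃ u : EuclideanSpace ℝ (Fin N) → ℝ, IsPositiveSolution Ω lam β q u) ∧
      (¬ ∃ u : EuclideanSpace ℝ (Fin N) → ℝ, IsNontrivialSolution Ω lam β q u)) := by
  have key : ∀ Ω : Set (EuclideanSpace ℝ (Fin N)), IsOpen Ω → Bornology.IsBounded Ω →
      StarConvex ℝ 0 Ω → ∀ u, ¬ IsNontrivialSolution Ω lam β q u := fun Ω h1 h2 h3 u =>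
    Pohozaev.not_isNontrivialSolution hN hβ hq hcases h1 h2 h3 u
  refine ⟨?_, fun Ω hΩ hstar => ⟨?_, ?_⟩⟩
  · rintro ⟨u, hu⟩
    exact key _ Metric.isOpen_ball Metric.isBounded_ball
      ((convex_ball 0 1).starConvex (Metric.mem_ball_self one_pos)) u
      (Pohozaev.isNontrivialSolution_of_isPositiveSolution hN Metric.isOpen_ball
        ⟨0, Metric.mem_ball_self one_pos⟩ hu)
  · rintro ⟨u, hu⟩
    exact key Ω hΩ.isOpen hΩ.isBounded hstar u
      (Pohozaev.isNontrivialSolution_of_isPositiveSolution hN hΩ.isOpen hΩ.isConnected.nonempty hu)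
  · rintro ⟨u, hu⟩
    exact key Ω hΩ.isOpen hΩ.isBounded hstar u hu
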